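/- **Model.** Let $d\ge 1$ and let $\mathcal G$ be either the orthogonal group $\mathcal O(d)$, or the rotation group $\mathcal{SO}(d)$ with $d\ge 2$. Let $n$ nodes be partitioned into $K\ge 1$ clusters of equal size $m=n/K\ge 1$ by a clustering function $C^*:[n]\to[K]$, and let $\bm R_1^*,\dots,\bm R_n^*\in\mathcal G$ be arbitrary group elements. Let $p,q\in[0,1]$. The stochastic group block model $\mathrm{SGBM}(n,p,q,K,d,\mathcal G)$ generates a random matrix $\bm A\in\mathbb R^{nd\times nd}$ with $d\times d$ blocks $$\bm A_{ij}=\begin{cases} w_{ij}\,\bm R_i^*\bm R_j^{*\top}, & i<j,\ C^*(i)=C^*(j),\\ u_{ij}\,\bm R_{ij}, & i<j,\ C^*(i)\ne C^*(j),\\ \bm A_{ji}^\top, & i>j,\\ \bm I_d, & i=j,\end{cases}$$ where $w_{ij}\sim\mathrm{Bern}(p)$, $u_{ij}\sim\mathrm{Bern}(q)$ and $\bm R_{ij}\sim\mathrm{Unif}(\mathcal G)$ (normalised Haar measure) are all independent. Let $\bm V^*\in\mathbb R^{nd\times Kd}$ be the ground truth matrix whose $(i,k)$-th $d\times d$ block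 is $\bm R_i^*$ if $C^*(i)=k$ and $\bm 0$ otherwise, and let $\|\cdot\|$ be the operator norm (largest singular value). **Proposition.** For every $K$, $d$ and $\mathcal G$ as above there exist constants $c_1,c_2,c_3,\gamma>0$, depending only on $K$, $d$ and $\mathcal G$, such that for all $n$, $m$, $p$, $q$, $C^*$ and $\bm R_1^*,\dots,\bm R_n^*$ as above, $$\mathbb P\left(\left\|\bm A-p\,\bm V^*\bm V^{*\top}\right\|\le c_1\sqrt{qm}+c_2\sqrt{pm}+c_3\sqrt{\log n}\right)\ \ge\ 1-n^{-\gamma}.$$ -/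

import Mathlib

open MeasureTheory ProbabilityTheory

/-! ### The groups `O(d)` and `SO(d)` and their uniform distributions -/

/-- The two admissible groups: the orthogonal group `O(d)` and the rotation group `SO(d)`. -/
inductive GroupKind where
  | orthogonal
  | special

/-- `SO(d)`, as the subgroup of matrices of determinant one in `O(d)`. -/
def rotationSubgroup (d : ℕ) : Subgroup (Matrix.orthogonalGroup (Fin d) ℝ) where
  carrier := {Q | (Q : Matrix (Fin d) (Fin d) ℝ).det = 1}
  one_mem' := by simp
  mul_mem' := by
    intro a b ha hb
    simp only [Set.mem_ofPred_eq] at ha hb ⊢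
    simp [Matrix.det_mul, ha, hb]
  inv_mem' := by
    intro a ha
    simp only [Set.mem_ofPred_eq] at ha ⊢
    have h : ((a⁻¹ : Matrix.orthogonalGroup (Fin d) ℝ) : Matrix (Fin d) (Fin d) ℝ).det *
        (a : Matrix (Fin d) (Fin d) ℝ).det = 1 := by
      rw [← Matrix.det_mul, ← Submonoid.coe_mul, inv_mul_cancel]
      simp
    simpa [ha] using h

/-- The group `𝒢`, equal to `O(d)` or to `SO(d)`, as a subgroup of `O(d)`. -/
def syncSubgroup (d : ℕ) : GroupKind → Subgroup (Matrix.orthogonalGroup (Fin d) ℝ)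
  | .orthogonal => ⊤
  | .special => rotationSubgroup d

/-- The type of elements of `𝒢 ∈ {O(d), SO(d)}`. -/
abbrev SyncGroup (d : ℕ) (𝒢 : GroupKind) : Type := syncSubgroup d 𝒢

/-- The `d × d` matrix underlying an element of `𝒢`. -/
def SyncGroup.mat {d : ℕ} {𝒢 : GroupKind} (Q : SyncGroup d 𝒢) : Matrix (Fin d) (Fin d) ℝ :=
  ((Q : Matrix.orthogonalGroup (Fin d) ℝ) : Matrix (Fin d) (Fin d) ℝ)

instance compactSpace_orthogonalGroup (d : ℕ) :
    CompactSpace (Matrix.orthogonalGroup (Fin d) ℝ) := by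
  refine isCompact_iff_compactSpace.mp ?_
  have hsub : ((Matrix.orthogonalGroup (Fin d) ℝ : Submonoid _) :
      Set (Matrix (Fin d) (Fin d) ℝ)) ⊆
      Set.pi Set.univ (fun _ => Set.pi Set.univ (fun _ => Set.Icc (-1 : ℝ) 1)) := by
    intro U hU i _ j _
    have := entry_norm_bound_of_unitary (𝕜 := ℝ) hU i j
    rw [Real.norm_eq_abs] at this
    exact abs_le.mp this
  refine IsCompact.of_isClosed_subset
    (isCompact_univ_pi fun _ => isCompact_univ_pi fun _ => isCompact_Icc) ?_ hsub
  have : ((Matrix.orthogonalGroup (Fin d) ℝ : Submonoid _) : Set (Matrix (Fin d) (Fin d) ℝ)) =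
      {U | U * U.transpose = 1} := by
    ext U
    exact Matrix.mem_orthogonalGroup_iff (Fin d) ℝ
  rw [this]
  exact isClosed_eq (by fun_prop) continuous_const

instance compactSpace_syncGroup (d : ℕ) (𝒢 : GroupKind) : CompactSpace (SyncGroup d 𝒢) := by
  refine isCompact_iff_compactSpace.mp (IsClosed.isCompact ?_)
  cases 𝒢 with
  | orthogonal => exact isClosed_univ
  | special =>
    exact isClosed_eq (Continuous.matrix_det continuous_subtype_val) continuous_const

/-- `𝒢` carries its Borel `σ`-algebra. -/
instance measurableSpace_syncGroup (d : ℕ) (𝒢 : GroupKind) : MeasurableSpace (SyncGroup d 𝒢) :=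
  borel _

instance borelSpace_syncGroup (d : ℕ) (𝒢 : GroupKind) : BorelSpace (SyncGroup d 𝒢) := ⟨rfl⟩

/-- `Unif(𝒢)`: the Haar measure of the compact group `𝒢`, normalised to have total mass one. -/
noncomputable def unif (d : ℕ) (𝒢 : GroupKind) : Measure (SyncGroup d 𝒢) :=
  Measure.haarMeasure ⊤

instance isProbabilityMeasure_unif (d : ℕ) (𝒢 : GroupKind) :
    IsProbabilityMeasure (unif d 𝒢) :=
  ⟨by simpa [unif] using
    Measure.haarMeasure_self (K₀ := (⊤ : TopologicalSpace.PositiveCompacts (SyncGroup d 𝒢)))⟩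

/-! ### Clusterings and the ground truth matrix -/

/-- The nodes are `Fin n`, and `C i` is the cluster of node `i`. The clustering is balanced when
each of the `K` clusters has exactly `m` nodes (so that `n = K * m`). -/
def IsBalanced {n K : ℕ} (m : ℕ) (C : Fin n → Fin K) : Prop :=
  ∀ k : Fin K, (Finset.univ.filter fun i => C i = k).card = m

/-- The clustering matrix `H ∈ {0,1}^{n × K}` of a clustering function. -/
def clusteringMatrix {n K : ℕ} (C : Fin n → Fin K) : Matrix (Fin n) (Fin K) ℝ :=
  Matrix.of fun i k => if C i = k then 1 else 0

/-- `V = (1_{1×K} ⊗ R) ⊙ (H ⊗ 1_{d×d}) ∈ ℝ^{nd × Kd}`: its `(i,k)`-th `d × d` block is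
`H i k • R i`. -/
def groundTruth {n K d : ℕ} {𝒢 : GroupKind} (C : Fin n → Fin K) (R : Fin n → SyncGroup d 𝒢) :
    Matrix (Fin n × Fin d) (Fin K × Fin d) ℝ :=
  Matrix.of fun x y => (R x.1).mat x.2 y.2 * clusteringMatrix C x.1 y.1

/-! ### The stochastic group block model -/

/-- The unordered pairs of distinct nodes, written as `(i, j)` with `i < j`. -/
abbrev NodePair (n : ℕ) : Type := {e : Fin n × Fin n // e.1 < e.2}

/-- An outcome: for each pair `i < j`, the indicator of the edge `{i, j}` and a group element
(the outlier measurement, which is used only when `i` and `j` lie in different clusters). -/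
abbrev SGBMOutcome (n d : ℕ) (𝒢 : GroupKind) : Type := NodePair n → Bool × SyncGroup d 𝒢

/-- The probability measure of the stochastic group block model: all edge indicators and all
outlier measurements are independent; the edge `{i, j}` is present with probability `p` if `i` and
`j` lie in the same cluster and with probability `q` otherwise; outliers are uniform on `𝒢`. -/
noncomputable def sgbm {n K : ℕ} (p q : unitInterval) (C : Fin n → Fin K) (d : ℕ)
    (𝒢 : GroupKind) : Measure (SGBMOutcome n d 𝒢) :=
  Measure.pi fun e : NodePair n =>
    (bernoulliMeasure true false (if C e.1.1 = C e.1.2 then p else q)).prod (unif d 𝒢)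

instance isProbabilityMeasure_sgbm {n K : ℕ} (p q : unitInterval) (C : Fin n → Fin K) (d : ℕ)
    (𝒢 : GroupKind) : IsProbabilityMeasure (sgbm p q C d 𝒢) := by
  unfold sgbm
  infer_instance

/-- The observed block `A_{ij}` for a pair `i < j`. -/
def upperBlock {n K d : ℕ} {𝒢 : GroupKind} (C : Fin n → Fin K) (R : Fin n → SyncGroup d 𝒢)
    (ω : SGBMOutcome n d 𝒢) (e : NodePair n) : Matrix (Fin d) (Fin d) ℝ :=
  if (ω e).1 = true then
    if C e.1.1 = C e.1.2 then (R e.1.1).mat * (R e.1.2).mat.transpose else (ω e).2.mat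
  else 0

/-- The observed block `A_{ij}`: `A_{ij} = A_{ji}ᵀ` below the diagonal, and `A_{ii} = I_d`. -/
def observationBlock {n K d : ℕ} {𝒢 : GroupKind} (C : Fin n → Fin K)
    (R : Fin n → SyncGroup d 𝒢) (ω : SGBMOutcome n d 𝒢) (i j : Fin n) :
    Matrix (Fin d) (Fin d) ℝ :=
  if hij : i < j then upperBlock C R ω ⟨(i, j), hij⟩
  else if hji : j < i then (upperBlock C R ω ⟨(j, i), hji⟩).transpose
  else 1

/-- The random observation matrix `A ∈ ℝ^{nd × nd}`. -/
def observation {n K d : ℕ} {𝒢 : GroupKind} (C : Fin n → Fin K) (R : Fin n → SyncGroup d 𝒢)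
    (ω : SGBMOutcome n d 𝒢) : Matrix (Fin n × Fin d) (Fin n × Fin d) ℝ :=
  Matrix.of fun x y => observationBlock C R ω x.1 y.1 x.2 y.2

/-- The operator norm (largest singular value) of a square real matrix: its norm as a linear
operator on Euclidean space. -/
noncomputable def opNorm {ι : Type} [Fintype ι] [DecidableEq ι] (X : Matrix ι ι ℝ) : ℝ :=
  ‖Matrix.toEuclideanCLM (n := ι) (𝕜 := ℝ) X‖

/-!
Up to the harmless diagonal term `(1 - p) • 1`, the matrix `A - p V Vᵀ` is symmetric with
independent centred blocks `X_e`, whose entries are bounded by one with mean absolute value at most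
`ρ = max (2 p (1 - p)) q`. We bound its norm by the trace method. In the expansion of
`𝔼 tr X ^ (2 k)` over closed walks on the `n` nodes only the walks that traverse each of their edges
at least twice survive, and such a walk with `v` vertices contributes at most `ρ ^ (v - 1)`.

The count of these walks needs no combinatorics. A walk with `v` vertices has
`n (n - 1) ⋯ (n - v + 1)` relabellings by `n` nodes, so if `n ρ ≤ k` the sum is at most `n` times
the number of such walks on `3 k` nodes. On these we place a symmetric matrix of independent centred
signs, skewed so that all their moments other than the first are at least one. The number of walks
is then at most the expected trace of the `2 k`-th power of that matrix, which an `ε`-net and the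
subgaussian moment bound show to be at most `(10 ^ 8 k) ^ k`. Markov's inequality with `k` of the
order of `(p + q) n + log n` concludes.
-/

/-! ### Walks and traces of powers -/

section WalkExpansion

variable {ι S : Type*} [Fintype ι] [DecidableEq ι] [CommSemiring S]

/-- The contribution `∏ₜ M_{w(t) w(t+1)}` of the walk `w` with `L` steps to the entries
of `M ^ L`. -/
def walkProd {L : ℕ} (M : Matrix ι ι S) (w : Fin (L + 1) → ι) : S :=
  ∏ t : Fin L, M (w t.castSucc) (w t.succ)

theorem pow_apply_eq_sum_walkProd (M : Matrix ι ι S) (L : ℕ) (i j : ι) :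
    (M ^ L) i j =
      ∑ w : Fin (L + 1) → ι, if w 0 = i ∧ w (Fin.last L) = j then walkProd M w else 0 := by
  induction L generalizing i with
  | zero =>
    rw [Fintype.sum_equiv (Equiv.funUnique (Fin 1) ι) _
      (fun x => if x = i then if x = j then (1 : S) else 0 else 0)
      fun w => by simp [walkProd, ite_and]]
    simp [Matrix.one_apply]
  | succ L ih =>
    rw [pow_succ', Matrix.mul_apply, ← (Fin.consEquiv (fun _ : Fin (L + 2) => ι)).sum_comp,
      Fintype.sum_prod_type]
    simp only [walkProd, Fin.consEquiv_apply, Fin.cons_zero, ← Fin.succ_last, Fin.cons_succ,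
      Fin.prod_univ_succ (n := L), Fin.castSucc_zero, ih, ite_and, Fin.castSucc_succ]
    simp only [Finset.mul_sum, Finset.sum_ite_irrel, Finset.sum_const_zero, Finset.sum_ite_eq',
      Finset.mem_univ, if_true]
    rw [Finset.sum_comm]
    refine Finset.sum_congr rfl fun w _ => ?_
    simp

theorem trace_pow_eq_sum_walkProd (M : Matrix ι ι S) (L : ℕ) :
    (M ^ L).trace =
      ∑ w : Fin (L + 1) → ι, if w 0 = w (Fin.last L) then walkProd M w else 0 := by
  simp only [Matrix.trace, Matrix.diag_apply, pow_apply_eq_sum_walkProd]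
  rw [Finset.sum_comm]
  refine Finset.sum_congr rfl fun w _ => ?_
  simp [ite_and, eq_comm]

end WalkExpansion

/-! ### Operator norms and traces -/

theorem norm_pow_le_norm_pow_of_isSelfAdjoint {E : Type*} [NormedRing E] [StarRing E] [CStarRing E]
    {a : E} (ha : IsSelfAdjoint a) {k : ℕ} (hk : 0 < k) : ‖a‖ ^ k ≤ ‖a ^ k‖ := by
  rcases eq_or_ne a 0 with rfl | h0
  · simp [hk.ne']
  have : 0 < ‖a‖ := norm_pos_iff.mpr h0
  have hlt : k < 2 ^ k := Nat.lt_two_pow_self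
  -- The C⋆-identity gives equality for exponents that are powers of two, so compare with `2 ^ k`.
  have hsplit : ‖a‖ ^ k * ‖a‖ ^ (2 ^ k - k) ≤ ‖a ^ k‖ * ‖a‖ ^ (2 ^ k - k) := by
    calc ‖a‖ ^ k * ‖a‖ ^ (2 ^ k - k) = ‖a ^ k * a ^ (2 ^ k - k)‖ := by
          rw [← pow_add, ← pow_add, Nat.add_sub_cancel' hlt.le, ha.norm_pow_two_pow]
      _ ≤ ‖a ^ k‖ * ‖a ^ (2 ^ k - k)‖ := norm_mul_le _ _
      _ ≤ _ := by gcongr; exact norm_pow_le' a (by omega)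
  exact le_of_mul_le_mul_right hsplit (by positivity)

section OpNorm

variable {ι : Type} [Fintype ι] [DecidableEq ι]

theorem opNorm_nonneg (X : Matrix ι ι ℝ) : 0 ≤ opNorm X := norm_nonneg _

theorem opNorm_add_le (X Y : Matrix ι ι ℝ) : opNorm (X + Y) ≤ opNorm X + opNorm Y := by
  simpa only [opNorm, map_add] using norm_add_le _ _

theorem opNorm_smul_one_le (c : ℝ) : opNorm (c • (1 : Matrix ι ι ℝ)) ≤ |c| := by
  rw [opNorm, map_smul, map_one, norm_smul, Real.norm_eq_abs]
  exact mul_le_of_le_one_right (abs_nonneg _) ContinuousLinearMap.norm_id_le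

theorem opNorm_pow_le (X : Matrix ι ι ℝ) {k : ℕ} (hk : 0 < k) : opNorm (X ^ k) ≤ opNorm X ^ k := by
  simpa only [opNorm, map_pow] using norm_pow_le' _ hk

theorem inner_toEuclideanCLM (X : Matrix ι ι ℝ) (x y : EuclideanSpace ℝ ι) :
    inner ℝ x (Matrix.toEuclideanCLM (n := ι) (𝕜 := ℝ) X y) = ∑ i, ∑ j, x i * X i j * y j := by
  simp [PiLp.inner_apply, Matrix.mulVec, dotProduct, Finset.mul_sum, mul_comm, mul_left_comm,
    mul_assoc]

theorem abs_apply_le_opNorm (X : Matrix ι ι ℝ) (i j : ι) : |X i j| ≤ opNorm X := by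
  have hentry : inner ℝ (EuclideanSpace.single i (1 : ℝ))
      (Matrix.toEuclideanCLM (n := ι) (𝕜 := ℝ) X (EuclideanSpace.single j 1)) = X i j := by
    simp [inner_toEuclideanCLM]
  rw [← hentry]
  refine (abs_real_inner_le_norm _ _).trans ?_
  simpa [opNorm] using
    (Matrix.toEuclideanCLM (n := ι) (𝕜 := ℝ) X).le_opNorm (EuclideanSpace.single j 1)

theorem trace_le_card_mul_opNorm (X : Matrix ι ι ℝ) : X.trace ≤ Fintype.card ι * opNorm X := by
  calc X.trace ≤ ∑ _i : ι, opNorm X :=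
        Finset.sum_le_sum fun i _ => (le_abs_self _).trans (abs_apply_le_opNorm X i i)
    _ = _ := by simp

theorem opNorm_sq_le_trace (X : Matrix ι ι ℝ) : opNorm X ^ 2 ≤ (X * X.transpose).trace := by
  have htrace : (X * X.transpose).trace = ∑ i, ∑ j, X i j ^ 2 := by
    simp [Matrix.trace, Matrix.mul_apply, sq]
  have hnonneg : 0 ≤ ∑ i, ∑ j, X i j ^ 2 := by positivity
  rw [htrace, ← Real.le_sqrt (opNorm_nonneg X) hnonneg]
  refine ContinuousLinearMap.opNorm_le_bound _ (Real.sqrt_nonneg _) fun x => ?_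
  rw [EuclideanSpace.norm_eq, EuclideanSpace.norm_eq, ← Real.sqrt_mul hnonneg, Finset.sum_mul]
  refine Real.sqrt_le_sqrt (Finset.sum_le_sum fun i _ => ?_)
  simp only [Real.norm_eq_abs, sq_abs, Matrix.ofLp_toEuclideanCLM, Matrix.mulVec, dotProduct]
  exact Finset.sum_mul_sq_le_sq_mul_sq _ _ _

theorem opNorm_pow_two_mul_le_trace {X : Matrix ι ι ℝ} (hX : X.transpose = X) {k : ℕ}
    (hk : 0 < k) : opNorm X ^ (2 * k) ≤ (X ^ (2 * k)).trace := by
  have hself : IsSelfAdjoint (Matrix.toEuclideanCLM (n := ι) (𝕜 := ℝ) X) :=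
    IsSelfAdjoint.map (x := X) (by simpa [IsSelfAdjoint, Matrix.star_eq_conjTranspose] using hX) _
  have hpow : opNorm X ^ k ≤ opNorm (X ^ k) := by
    simpa only [opNorm, map_pow] using norm_pow_le_norm_pow_of_isSelfAdjoint hself hk
  calc opNorm X ^ (2 * k) = (opNorm X ^ k) ^ 2 := by rw [mul_comm, pow_mul]
    _ ≤ opNorm (X ^ k) ^ 2 := pow_le_pow_left₀ (pow_nonneg (opNorm_nonneg _) _) hpow 2
    _ ≤ (X ^ k * (X ^ k).transpose).trace := opNorm_sq_le_trace _
    _ = _ := by rw [Matrix.transpose_pow, hX, ← pow_add, two_mul]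

end OpNorm

/-! ### Nets -/

section Nets

variable {E F : Type*} [NormedAddCommGroup E] [NormedSpace ℝ E]
  [NormedAddCommGroup F] [NormedSpace ℝ F]

open Metric in
theorem packingNumber_half_closedBall_le (E : Type*) [NormedAddCommGroup E] [NormedSpace ℝ E]
    [FiniteDimensional ℝ E] :
    packingNumber (1 / 2) (closedBall (0 : E) 1) ≤ (5 ^ Module.finrank ℝ E : ℕ) := by
  classical
  refine iSup_le fun s => iSup_le fun hsub => iSup_le fun hsep => ?_
  by_contra! hcard
  obtain ⟨u, hus, hu⟩ := Set.exists_subset_encard_eq (Order.add_one_le_of_lt hcard)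
  lift u to Finset E using Set.finite_of_encard_eq_coe (by exact_mod_cast hu)
  have hle := Besicovitch.card_le_of_separated (u.image ((2 : ℝ) • ·)) ?_ ?_
  · rw [Finset.card_image_of_injective u (smul_right_injective E two_ne_zero)] at hle
    rw [Set.encard_coe_eq_coe_finsetCard] at hu
    norm_cast at hu
    omega
  · simp only [Finset.forall_mem_image, norm_smul, Real.norm_ofNat]
    intro x hx
    have := mem_closedBall_zero_iff.mp (hsub (hus hx))
    linarith
  · simp only [Finset.forall_mem_image, ← smul_sub, norm_smul, Real.norm_ofNat]
    intro x hx y hy hxy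
    have hdist : (1 / 2 : ℝ) < ‖x - y‖ := by
      have : ((1 / 2 : NNReal) : ENNReal) < edist x y :=
        hsep (hus hx) (hus hy) (by rintro rfl; exact hxy rfl)
      rw [edist_dist, dist_eq_norm, ENNReal.lt_ofReal_iff_toReal_lt ENNReal.coe_ne_top] at this
      simpa using this
    linarith

open Metric in
theorem exists_half_net_closedBall (E : Type*) [NormedAddCommGroup E] [NormedSpace ℝ E]
    [FiniteDimensional ℝ E] :
    ∃ N : Finset E, N.card ≤ 5 ^ Module.finrank ℝ E ∧ (∀ x ∈ N, ‖x‖ ≤ 1) ∧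
      ∀ x : E, ‖x‖ ≤ 1 → ∃ y ∈ N, ‖x - y‖ ≤ 1 / 2 := by
  set A := closedBall (0 : E) 1
  have hcover : coveringNumber (1 / 2) A ≤ (5 ^ Module.finrank ℝ E : ℕ) :=
    (coveringNumber_le_packingNumber _ _).trans (packingNumber_half_closedBall_le E)
  have hfinite : coveringNumber (1 / 2) A ≠ ⊤ := (hcover.trans_lt (ENat.natCast_lt_top _)).ne
  have hfin : (minimalCover (1 / 2) A).Finite := finite_minimalCover
  refine ⟨hfin.toFinset, ?_, fun x hx => ?_, fun x hx => ?_⟩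
  · rwa [← encard_minimalCover hfinite, hfin.encard_eq_coe_toFinset_card, Nat.cast_le] at hcover
  · exact mem_closedBall_zero_iff.mp (minimalCover_subset (hfin.mem_toFinset.mp hx))
  · obtain ⟨y, hy, hxy⟩ := isCover_minimalCover hfinite (mem_closedBall_zero_iff.mpr hx)
    refine ⟨y, hfin.mem_toFinset.mpr hy, ?_⟩
    have hedist : edist x y ≤ ((1 / 2 : NNReal) : ENNReal) := hxy
    rw [edist_le_coe, nndist_eq_nnnorm, ← NNReal.coe_le_coe] at hedist
    simpa using hedist

theorem exists_norm_le_two_mul_of_half_net {N : Finset E}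
    (hN : ∀ x : E, ‖x‖ ≤ 1 → ∃ y ∈ N, ‖x - y‖ ≤ 1 / 2) (T : E →L[ℝ] F) :
    ∃ y ∈ N, ‖T‖ ≤ 2 * ‖T y‖ := by
  have hne : N.Nonempty := let ⟨y, hy, _⟩ := hN 0 (by simp); ⟨y, hy⟩
  obtain ⟨y, hy, hmax⟩ := N.exists_max_image (fun y => ‖T y‖) hne
  have hstep : ‖T‖ ≤ ‖T y‖ + ‖T‖ * (1 / 2) := by
    refine ContinuousLinearMap.opNorm_le_of_unit_norm (by positivity) fun x hx => ?_
    obtain ⟨z, hz, hxz⟩ := hN x hx.le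
    calc ‖T x‖ = ‖T z + T (x - z)‖ := by rw [← map_add, add_sub_cancel]
      _ ≤ ‖T z‖ + ‖T (x - z)‖ := norm_add_le _ _
      _ ≤ ‖T y‖ + ‖T‖ * (1 / 2) := add_le_add (hmax z hz) (T.le_opNorm_of_le hxz)
  exact ⟨y, hy, by linarith⟩

variable {ι : Type} [Fintype ι] [DecidableEq ι] {N : Finset (EuclideanSpace ℝ ι)}

theorem exists_opNorm_le_four_mul_of_half_net
    (hN : ∀ x : EuclideanSpace ℝ ι, ‖x‖ ≤ 1 → ∃ y ∈ N, ‖x - y‖ ≤ 1 / 2) (X : Matrix ι ι ℝ) :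
    ∃ z ∈ N ×ˢ N, opNorm X ≤ 4 * |∑ i, ∑ j, z.1 i * X i j * z.2 j| := by
  obtain ⟨y, hy, hXy⟩ :=
    exists_norm_le_two_mul_of_half_net hN (Matrix.toEuclideanCLM (n := ι) (𝕜 := ℝ) X)
  obtain ⟨x, hx, hxy⟩ := exists_norm_le_two_mul_of_half_net hN
    (innerSL ℝ (Matrix.toEuclideanCLM (n := ι) (𝕜 := ℝ) X y))
  rw [innerSL_apply_norm, innerSL_apply_apply, real_inner_comm, inner_toEuclideanCLM,
    Real.norm_eq_abs] at hxy
  exact ⟨(x, y), Finset.mk_mem_product hx hy, by unfold opNorm; linarith⟩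

theorem opNorm_pow_two_mul_le_sum_of_half_net
    (hN : ∀ x : EuclideanSpace ℝ ι, ‖x‖ ≤ 1 → ∃ y ∈ N, ‖x - y‖ ≤ 1 / 2) (X : Matrix ι ι ℝ)
    (k : ℕ) :
    opNorm X ^ (2 * k) ≤ 16 ^ k * ∑ z ∈ N ×ˢ N, (∑ i, ∑ j, z.1 i * X i j * z.2 j) ^ (2 * k) := by
  obtain ⟨z, hz, hXz⟩ := exists_opNorm_le_four_mul_of_half_net hN X
  calc opNorm X ^ (2 * k) ≤ (4 * |∑ i, ∑ j, z.1 i * X i j * z.2 j|) ^ (2 * k) :=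
        pow_le_pow_left₀ (opNorm_nonneg X) hXz _
    _ = 16 ^ k * (∑ i, ∑ j, z.1 i * X i j * z.2 j) ^ (2 * k) := by
        rw [mul_pow, (even_two_mul k).pow_abs, pow_mul]
        norm_num
    _ ≤ _ := by
        refine mul_le_mul_of_nonneg_left ?_ (by positivity)
        exact Finset.single_le_sum
          (f := fun z : EuclideanSpace ℝ ι × EuclideanSpace ℝ ι =>
            (∑ i, ∑ j, z.1 i * X i j * z.2 j) ^ (2 * k))
          (fun z _ => (even_two_mul k).pow_nonneg _) hz

end Nets

/-! ### Walks up to relabelling of the vertices -/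

section SameShape

variable {τ α β : Type*}

/-- Two walks (or any two families indexed by the same type) that agree up to a relabelling of the
vertices. -/
def SameShape (u : τ → α) (w : τ → β) : Prop :=
  ∀ a b, u a = u b ↔ w a = w b

theorem SameShape.symm {u : τ → α} {w : τ → β} (h : SameShape u w) : SameShape w u :=
  fun a b => (h a b).symm

/-- The number of distinct vertices visited by a walk. -/
noncomputable def vertexCount (w : τ → α) : ℕ := (Set.range w).ncard

theorem SameShape.vertexCount_eq {u : τ → α} {w : τ → β} (h : SameShape u w) :
    vertexCount u = vertexCount w := by
  have hker : Setoid.ker u = Setoid.ker w := Setoid.ext h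
  exact Nat.card_congr ((Setoid.quotientKerEquivRange u).symm.trans
    ((Quotient.congrRight fun a b => by rw [hker]).trans (Setoid.quotientKerEquivRange w)))

theorem vertexCount_pos [Finite τ] [Nonempty τ] (w : τ → α) : 0 < vertexCount w :=
  (Set.ncard_pos (Set.finite_range w)).mpr (Set.range_nonempty w)

theorem vertexCount_le_card [Fintype τ] (w : τ → α) : vertexCount w ≤ Fintype.card τ := by
  simpa [vertexCount, ← Set.image_univ] using Set.ncard_image_le (f := w) Set.finite_univ

theorem range_embedding_comp_rangeFactorization (u : τ → α) :
    Set.range (fun (g : Set.range u ↪ β) a => g (Set.rangeFactorization u a)) =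
      {w | SameShape u w} := by
  refine Set.Subset.antisymm ?_ fun w hw => ?_
  · rintro _ ⟨g, rfl⟩ a b
    simp [Set.rangeFactorization]
  · have hsection : ∀ x : Set.range u, u x.2.choose = x := fun x => x.2.choose_spec
    refine ⟨⟨fun x => w x.2.choose, fun x y hxy => ?_⟩, funext fun a => ?_⟩
    · rw [Subtype.ext_iff, ← hsection x, ← hsection y]
      exact (hw _ _).mpr hxy
    · exact (hw _ _).mp (hsection (Set.rangeFactorization u a))

theorem ncard_sameShape [Finite τ] [Fintype β] (u : τ → α) :
    {w : τ → β | SameShape u w}.ncard = (Fintype.card β).descFactorial (vertexCount u) := by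
  classical
  have hinj : Function.Injective
      fun (g : Set.range u ↪ β) a => g (Set.rangeFactorization u a) := fun g g' h =>
    DFunLike.coe_injective (Set.rangeFactorization_surjective.injective_comp_right h)
  rw [← range_embedding_comp_rangeFactorization, ← Nat.card_coe_set_eq,
    Nat.card_range_of_injective hinj]
  have := Fintype.ofFinite (Set.range u)
  rw [Nat.card_eq_fintype_card, Fintype.card_embedding_eq, vertexCount, ← Nat.card_coe_set_eq,
    Nat.card_eq_fintype_card]

variable [Fintype τ]

open Classical in
theorem sum_ite_sameShape [DecidableEq τ] [Fintype β] (u : τ → α) (c : ℝ) :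
    (∑ w : τ → β, if SameShape u w then c else 0) =
      (Fintype.card β).descFactorial (vertexCount u) * c := by
  rw [← ncard_sameShape u, ← Finset.sum_filter, Finset.sum_const, nsmul_eq_mul,
    ← Set.ncard_coe_finset, Finset.coe_filter_univ]

theorem sum_le_sum_of_sameShape [DecidableEq τ] [Fintype α] [Fintype β] {F : (τ → α) → ℝ}
    {G : (τ → β) → ℝ}
    (hcard : Fintype.card τ ≤ Fintype.card β) (hG : ∀ w, 0 ≤ G w)
    (hFG : ∀ u w, SameShape u w → (Fintype.card α).descFactorial (vertexCount u) * F u ≤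
      (Fintype.card β).descFactorial (vertexCount u) * G w) :
    ∑ u, F u ≤ ∑ w, G w := by
  classical
  set a : ℕ → ℝ := fun v => (Fintype.card α).descFactorial v
  set b : ℕ → ℝ := fun v => (Fintype.card β).descFactorial v
  have ha : ∀ u : τ → α, 0 < a (vertexCount u) := fun u =>
    Nat.cast_pos.mpr (Nat.descFactorial_pos.mpr
      ((Set.ncard_le_card _).trans_eq Nat.card_eq_fintype_card))
  have hb : ∀ u : τ → α, 0 < b (vertexCount u) := fun u =>
    Nat.cast_pos.mpr (Nat.descFactorial_pos.mpr ((vertexCount_le_card u).trans hcard))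
  -- Count the pairs of walks of the same shape in two ways.
  calc ∑ u, F u
      = ∑ u, ∑ w : τ → β, if SameShape u w then F u / b (vertexCount u) else 0 :=
        Finset.sum_congr rfl fun u _ => by
          rw [sum_ite_sameShape, mul_div_cancel₀ _ (hb u).ne']
    _ = ∑ w, ∑ u, if SameShape u w then F u / b (vertexCount u) else 0 := Finset.sum_comm
    _ ≤ ∑ w, ∑ u : τ → α, if SameShape w u then G w / a (vertexCount w) else 0 := by
        refine Finset.sum_le_sum fun w _ => Finset.sum_le_sum fun u _ => ?_
        by_cases h : SameShape u w
        · rw [if_pos h, if_pos h.symm, ← h.vertexCount_eq, div_le_div_iff₀ (hb u) (ha u)]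
          linarith [hFG u w h]
        · rw [if_neg h, if_neg fun h' => h h'.symm]
    _ ≤ ∑ w, G w := Finset.sum_le_sum fun w _ => by
        rw [sum_ite_sameShape]
        rcases (Nat.cast_nonneg _ : 0 ≤ a (vertexCount w)).eq_or_lt with h0 | h0
        · simpa [a, ← h0] using hG w
        · rw [mul_div_cancel₀ _ h0.ne']

end SameShape

section DoubledWalks

variable {L : ℕ} {α β : Type*}

/-- The edge traversed by a walk in its `t`-th step. -/
def walkEdge (w : Fin (L + 1) → α) (t : Fin L) : Sym2 α := s(w t.castSucc, w t.succ)

/-- A closed walk without loops which traverses each of its edges at least twice. -/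
def IsDoubledClosedWalk (w : Fin (L + 1) → α) : Prop :=
  w 0 = w (Fin.last L) ∧ (∀ t : Fin L, w t.castSucc ≠ w t.succ) ∧
    ∀ t, ∃ t', t' ≠ t ∧ walkEdge w t' = walkEdge w t

theorem SameShape.isDoubledClosedWalk_iff {u : Fin (L + 1) → α} {w : Fin (L + 1) → β}
    (h : SameShape u w) : IsDoubledClosedWalk u ↔ IsDoubledClosedWalk w := by
  simp only [IsDoubledClosedWalk, walkEdge, Sym2.eq_iff, ne_eq, h _ _]

theorem vertexCount_le_vertexCount_walkEdge_add_one (u : Fin (L + 1) → α) :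
    vertexCount u ≤ vertexCount (walkEdge u) + 1 := by
  induction L with
  | zero => exact (vertexCount_le_card u).trans (by simp)
  | succ L ih =>
    have hvertices : Set.range u =
        insert (u (Fin.last (L + 1))) (Set.range fun a : Fin (L + 1) => u a.castSucc) := by
      ext x
      simp only [Set.mem_range, Set.mem_insert_iff, Fin.exists_fin_succ' (n := L + 1)]
      tauto
    have hedges : Set.range (walkEdge u) = insert s(u (Fin.last L).castSucc, u (Fin.last (L + 1)))
        (Set.range (walkEdge fun a : Fin (L + 1) => u a.castSucc)) := by
      ext x
      simp only [walkEdge, Set.mem_range, Set.mem_insert_iff, Fin.exists_fin_succ' (n := L),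
        Fin.succ_last, Fin.succ_castSucc]
      tauto
    have ih := ih fun a => u a.castSucc
    unfold vertexCount at ih ⊢
    rw [hvertices, hedges]
    by_cases hmem : u (Fin.last (L + 1)) ∈ Set.range fun a : Fin (L + 1) => u a.castSucc
    · rw [Set.insert_eq_of_mem hmem]
      exact ih.trans (Nat.add_le_add_right (Set.ncard_le_ncard (Set.subset_insert _ _)) 1)
    · rw [Set.ncard_insert_of_notMem hmem, Set.ncard_insert_of_notMem]
      · omega
      · rintro ⟨t, ht⟩
        have hlast : u (Fin.last (L + 1)) ∈ walkEdge (fun a : Fin (L + 1) => u a.castSucc) t :=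
          ht ▸ Sym2.mem_mk_right _ _
        rcases Sym2.mem_iff.mp hlast with h | h <;> exact hmem ⟨_, h.symm⟩

theorem descFactorial_mul_pow_le {n r k v : ℕ} {ρ : ℝ} (hρ : 0 ≤ ρ) (hk : 0 < k)
    (hnρ : n * ρ ≤ k) (hr : v + k ≤ r) :
    n.descFactorial (v + 1) * ρ ^ v ≤ r.descFactorial (v + 1) * (n : ℝ) := by
  have hdesc : k ^ (v + 1) ≤ r.descFactorial (v + 1) :=
    (Nat.pow_le_pow_left (by omega) _).trans (Nat.pow_sub_le_descFactorial r (v + 1))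
  calc (n.descFactorial (v + 1) : ℝ) * ρ ^ v ≤ (n : ℝ) ^ (v + 1) * ρ ^ v := by
        gcongr
        exact_mod_cast Nat.descFactorial_le_pow n (v + 1)
    _ = n * (n * ρ) ^ v := by ring
    _ ≤ n * (k : ℝ) ^ v := by gcongr
    _ ≤ n * (k : ℝ) ^ (v + 1) := by
        gcongr
        · exact_mod_cast hk
        · simp
    _ ≤ r.descFactorial (v + 1) * (n : ℝ) := by
        rw [mul_comm]
        gcongr
        exact_mod_cast hdesc

open Classical in
theorem sum_isDoubledClosedWalk_le_mul_card {n r k : ℕ} {ρ : ℝ} (hρ : 0 ≤ ρ) (hk : 0 < k)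
    (hnρ : n * ρ ≤ k) (hr : L + k ≤ r) :
    (∑ u : Fin (L + 1) → Fin n, if IsDoubledClosedWalk u then ρ ^ (vertexCount u - 1) else 0) ≤
      n * (Finset.univ.filter fun w : Fin (L + 1) → Fin r => IsDoubledClosedWalk w).card := by
  have hcount (u : Fin (L + 1) → Fin n) :
      n.descFactorial (vertexCount u) * ρ ^ (vertexCount u - 1) ≤
        r.descFactorial (vertexCount u) * (n : ℝ) := by
    obtain ⟨v, hv⟩ := Nat.exists_eq_add_one_of_ne_zero (vertexCount_pos u).ne'
    have hvL : v + 1 ≤ L + 1 := by simpa [hv] using vertexCount_le_card u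
    rw [hv, Nat.add_sub_cancel]
    exact descFactorial_mul_pow_le hρ hk hnρ (by omega)
  calc (∑ u : Fin (L + 1) → Fin n, if IsDoubledClosedWalk u then ρ ^ (vertexCount u - 1) else 0)
      ≤ ∑ w : Fin (L + 1) → Fin r, if IsDoubledClosedWalk w then (n : ℝ) else 0 := by
        refine sum_le_sum_of_sameShape (by simp only [Fintype.card_fin]; omega)
          (fun w => by split_ifs <;> simp) fun u w h => ?_
        simp only [Fintype.card_fin, h.isDoubledClosedWalk_iff]
        split_ifs
        · exact hcount u
        · simp
    _ = _ := by rw [← Finset.sum_filter, Finset.sum_const, nsmul_eq_mul, mul_comm]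

end DoubledWalks

/-! ### Moments of symmetric random matrices with independent blocks -/

section NodePairs

variable {n : ℕ}

/-- The unordered pair of two distinct nodes, as an element of `NodePair n`. -/
def nodePair (i j : Fin n) (h : i ≠ j) : NodePair n :=
  if hlt : i < j then ⟨(i, j), hlt⟩ else ⟨(j, i), lt_of_le_of_ne (not_lt.mp hlt) h.symm⟩

theorem mk_nodePair (i j : Fin n) (h : i ≠ j) :
    s((nodePair i j h).1.1, (nodePair i j h).1.2) = s(i, j) := by
  unfold nodePair
  split_ifs
  · rfl
  · exact Sym2.eq_swap

theorem nodePair_eq_iff {i j i' j' : Fin n} (h : i ≠ j) (h' : i' ≠ j') :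
    nodePair i j h = nodePair i' j' h' ↔ s(i, j) = s(i', j') := by
  rw [← mk_nodePair i j h, ← mk_nodePair i' j' h']
  refine ⟨fun heq => by rw [heq], fun heq => ?_⟩
  rcases Sym2.eq_iff.mp heq with ⟨hfst, hsnd⟩ | ⟨hfst, hsnd⟩
  · exact Subtype.ext (Prod.ext hfst hsnd)
  · have hlt := (nodePair i j h).2
    rw [hfst, hsnd] at hlt
    exact absurd hlt (nodePair i' j' h').2.asymm

end NodePairs

section IntegralProd

variable {τ E Ω : Type*} [Fintype τ] [Fintype E] [MeasurableSpace Ω]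
  (μ : E → Measure Ω) [∀ a, IsProbabilityMeasure (μ a)]

theorem integral_prod_comp_eval [DecidableEq E] (e : τ → E) (f : τ → Ω → ℝ) :
    ∫ ω, ∏ t, f t (ω (e t)) ∂Measure.pi μ = ∏ a, ∫ x, ∏ t with e t = a, f t x ∂μ a := by
  rw [← integral_fintype_prod_eq_prod]
  refine integral_congr_ae (ae_of_all _ fun ω => ?_)
  simp only [← Finset.prod_fiberwise Finset.univ e fun t => f t (ω (e t))]
  refine Finset.prod_congr rfl fun a _ => Finset.prod_congr rfl fun t ht => ?_
  rw [(Finset.mem_filter.mp ht).2]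

theorem integral_prod_comp_eval_eq_zero (e : τ → E) (f : τ → Ω → ℝ) (t : τ)
    (ht : ∀ t', t' ≠ t → e t' ≠ e t) (hf : ∫ x, f t x ∂μ (e t) = 0) :
    ∫ ω, ∏ t, f t (ω (e t)) ∂Measure.pi μ = 0 := by
  classical
  rw [integral_prod_comp_eval]
  refine Finset.prod_eq_zero (Finset.mem_univ (e t)) ?_
  have hfiber : (Finset.univ.filter fun t' => e t' = e t) = {t} := by
    ext t'
    simpa using ⟨fun h => not_imp_not.mp (ht t') h, fun h => h ▸ rfl⟩
  simpa only [hfiber, Finset.prod_singleton] using hf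

/-- A centred random variable bounded by one whose mean absolute value is at most `ρ`: the
properties shared by the centred entries of a sparse random matrix. -/
structure IsCentredSparse (ν : Measure Ω) (ρ : ℝ) (f : Ω → ℝ) : Prop where
  measurable : Measurable f
  abs_le_one : ∀ x, |f x| ≤ 1
  integral_eq_zero : ∫ x, f x ∂ν = 0
  integral_abs_le : ∫ x, |f x| ∂ν ≤ ρ

theorem IsCentredSparse.integrable {ν : Measure Ω} [IsFiniteMeasure ν] {ρ : ℝ} {f : Ω → ℝ}
    (hf : IsCentredSparse ν ρ f) : Integrable f ν :=
  .of_bound hf.measurable.aestronglyMeasurable 1 (ae_of_all _ hf.abs_le_one)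

theorem integral_prod_comp_eval_le (e : τ → E) (f : τ → Ω → ℝ) {ρ : ℝ}
    (hf : ∀ t, IsCentredSparse (μ (e t)) ρ (f t)) :
    ∫ ω, ∏ t, f t (ω (e t)) ∂Measure.pi μ ≤ ρ ^ vertexCount e := by
  classical
  have hcount : vertexCount e = (Finset.univ.image e).card := by
    rw [vertexCount, ← Set.ncard_coe_finset, Finset.coe_image, Finset.coe_univ, Set.image_univ]
  rw [integral_prod_comp_eval, hcount, ← Finset.prod_const,
    ← Finset.prod_subset (Finset.subset_univ (Finset.univ.image e)) fun a _ ha => ?_]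
  · refine (le_abs_self _).trans ?_
    rw [Finset.abs_prod]
    refine Finset.prod_le_prod (fun _ _ => abs_nonneg _) fun a ha => ?_
    obtain ⟨t, -, rfl⟩ := Finset.mem_image.mp ha
    rw [← Real.norm_eq_abs]
    have ht : t ∈ Finset.univ.filter fun t' => e t' = e t := by simp
    refine (norm_integral_le_of_norm_le (hf t).integrable.abs (ae_of_all _ fun x => ?_)).trans
      (hf t).integral_abs_le
    rw [Real.norm_eq_abs, Finset.abs_prod, ← Finset.mul_prod_erase _ _ ht]
    refine mul_le_of_le_one_right (abs_nonneg _) ?_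
    exact Finset.prod_le_one (fun _ _ => abs_nonneg _) fun t' _ => (hf t').abs_le_one x
  · have hfiber : (Finset.univ.filter fun t => e t = a) = ∅ :=
      Finset.filter_eq_empty_iff.mpr fun t _ h =>
        ha (h ▸ Finset.mem_image_of_mem _ (Finset.mem_univ t))
    simp [hfiber]

end IntegralProd

section EdgeMatrix

variable {n L : ℕ} {ι : Type*} (node : ι → Fin n)

/-- The symmetric matrix with rows and columns attached to nodes that vanishes between indices of
the same node, and whose entries between the nodes of a pair `e = (i, j)`, `i < j`, are those of
`B e`. -/
def edgeMatrix (B : NodePair n → Matrix ι ι ℝ) : Matrix ι ι ℝ :=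
  Matrix.of fun x y =>
    if h : node x < node y then B ⟨(node x, node y), h⟩ x y
    else if h : node y < node x then B ⟨(node y, node x), h⟩ y x
    else 0

theorem transpose_edgeMatrix (B : NodePair n → Matrix ι ι ℝ) :
    (edgeMatrix node B).transpose = edgeMatrix node B := by
  ext x y
  simp only [edgeMatrix, Matrix.transpose_apply, Matrix.of_apply]
  split_ifs with h h'
  · exact absurd h h'.asymm
  all_goals rfl

variable {node}

theorem edgeMatrix_apply_eq_zero {x y : ι} (h : node x = node y) (B : NodePair n → Matrix ι ι ℝ) :
    edgeMatrix node B x y = 0 := by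
  simp [edgeMatrix, h]

theorem exists_edgeMatrix_apply {x y : ι} (h : node x ≠ node y) :
    ∃ a b, ∀ B, edgeMatrix node B x y = B (nodePair (node x) (node y) h) a b := by
  rcases h.lt_or_gt with hlt | hgt
  · exact ⟨x, y, fun B => by simp [edgeMatrix, nodePair, hlt]⟩
  · exact ⟨y, x, fun B => by simp [edgeMatrix, nodePair, hgt, hgt.not_gt]⟩

theorem walkProd_edgeMatrix_eq_zero {w : Fin (L + 1) → ι} {t : Fin L}
    (ht : node (w t.castSucc) = node (w t.succ)) (B : NodePair n → Matrix ι ι ℝ) :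
    walkProd (edgeMatrix node B) w = 0 :=
  Finset.prod_eq_zero (Finset.mem_univ t) (edgeMatrix_apply_eq_zero ht B)

theorem exists_walkProd_edgeMatrix {w : Fin (L + 1) → ι}
    (hloop : ∀ t : Fin L, node (w t.castSucc) ≠ node (w t.succ)) :
    ∃ a b : Fin L → ι, ∀ B, walkProd (edgeMatrix node B) w =
      ∏ t, B (nodePair _ _ (hloop t)) (a t) (b t) := by
  choose a b hab using fun t => exists_edgeMatrix_apply (hloop t)
  exact ⟨a, b, fun B => Finset.prod_congr rfl fun t _ => hab t B⟩

theorem abs_edgeMatrix_apply_le {B : NodePair n → Matrix ι ι ℝ} {C : ℝ} (hC : 0 ≤ C)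
    (hB : ∀ e x y, |B e x y| ≤ C) (x y : ι) : |edgeMatrix node B x y| ≤ C := by
  by_cases h : node x = node y
  · simpa [edgeMatrix_apply_eq_zero h] using hC
  · obtain ⟨a, b, hab⟩ := exists_edgeMatrix_apply h
    exact hab B ▸ hB _ _ _

variable {Ω : Type*} [MeasurableSpace Ω] {Φ : NodePair n → Ω → Matrix ι ι ℝ}

theorem measurable_edgeMatrix_apply (hΦ : ∀ e x y, Measurable fun ω => Φ e ω x y) (x y : ι) :
    Measurable fun ω : NodePair n → Ω => edgeMatrix node (fun e => Φ e (ω e)) x y := by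
  by_cases h : node x = node y
  · simp only [edgeMatrix_apply_eq_zero h, measurable_const]
  · obtain ⟨a, b, hab⟩ := exists_edgeMatrix_apply h
    simp only [hab]
    exact (hΦ _ a b).comp (measurable_pi_apply _)

variable {μ : NodePair n → Measure Ω} [∀ e, IsProbabilityMeasure (μ e)]

theorem integral_walkProd_edgeMatrix_eq_zero (hΦ : ∀ e x y, ∫ ω, Φ e ω x y ∂μ e = 0)
    {w : Fin (L + 1) → ι} (hclosed : w 0 = w (Fin.last L))
    (hw : ¬ IsDoubledClosedWalk fun a => node (w a)) :
    ∫ ω, walkProd (edgeMatrix node fun e => Φ e (ω e)) w ∂Measure.pi μ = 0 := by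
  by_cases hloop : ∀ t : Fin L, node (w t.castSucc) ≠ node (w t.succ)
  · obtain ⟨a, b, hab⟩ := exists_walkProd_edgeMatrix hloop
    obtain ⟨t, ht⟩ : ∃ t, ∀ t', t' ≠ t →
        walkEdge (fun a => node (w a)) t' ≠ walkEdge (fun a => node (w a)) t := by
      by_contra! hdouble
      exact hw ⟨congrArg node hclosed, hloop, hdouble⟩
    simp only [hab]
    exact integral_prod_comp_eval_eq_zero μ (fun t => nodePair _ _ (hloop t))
      (fun t ω => Φ _ ω (a t) (b t)) t (fun t' hne => mt (nodePair_eq_iff _ _).mp (ht t' hne))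
      (hΦ _ _ _)
  · push Not at hloop
    obtain ⟨t, ht⟩ := hloop
    simp only [walkProd_edgeMatrix_eq_zero ht, integral_zero]

theorem integral_walkProd_edgeMatrix_le {ρ : ℝ} (hρ0 : 0 ≤ ρ) (hρ1 : ρ ≤ 1)
    (hΦ : ∀ e x y, IsCentredSparse (μ e) ρ fun ω => Φ e ω x y) {w : Fin (L + 1) → ι}
    (hloop : ∀ t : Fin L, node (w t.castSucc) ≠ node (w t.succ)) :
    ∫ ω, walkProd (edgeMatrix node fun e => Φ e (ω e)) w ∂Measure.pi μ ≤
      ρ ^ (vertexCount (fun a => node (w a)) - 1) := by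
  obtain ⟨a, b, hab⟩ := exists_walkProd_edgeMatrix hloop
  have hshape : SameShape (walkEdge fun a => node (w a)) fun t => nodePair _ _ (hloop t) :=
    fun s t => (nodePair_eq_iff (hloop s) (hloop t)).symm
  have hcount := vertexCount_le_vertexCount_walkEdge_add_one fun a => node (w a)
  simp only [hab]
  calc ∫ ω, ∏ t, Φ _ (ω (nodePair _ _ (hloop t))) (a t) (b t) ∂Measure.pi μ
      ≤ ρ ^ vertexCount fun t => nodePair _ _ (hloop t) :=
        integral_prod_comp_eval_le μ _ (fun t ω => Φ _ ω (a t) (b t)) fun t => hΦ _ _ _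
    _ = ρ ^ vertexCount (walkEdge fun a => node (w a)) := by rw [hshape.vertexCount_eq]
    _ ≤ _ := pow_le_pow_of_le_one hρ0 hρ1 (by omega)

theorem integrable_walkProd_edgeMatrix {ρ : ℝ}
    (hΦ : ∀ e x y, IsCentredSparse (μ e) ρ fun ω => Φ e ω x y) (w : Fin (L + 1) → ι) :
    Integrable (fun ω => walkProd (edgeMatrix node fun e => Φ e (ω e)) w) (Measure.pi μ) := by
  refine .of_bound (Finset.measurable_prod _ fun t _ => measurable_edgeMatrix_apply
    (fun e x y => (hΦ e x y).measurable) _ _).aestronglyMeasurable 1 (ae_of_all _ fun ω => ?_)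
  rw [Real.norm_eq_abs, walkProd, Finset.abs_prod]
  exact Finset.prod_le_one (fun _ _ => abs_nonneg _) fun t _ =>
    abs_edgeMatrix_apply_le zero_le_one (fun e x y => (hΦ e x y).abs_le_one _) _ _

variable [DecidableEq ι]

theorem integrable_ite_walkProd_edgeMatrix {ρ : ℝ}
    (hΦ : ∀ e x y, IsCentredSparse (μ e) ρ fun ω => Φ e ω x y) (w : Fin (L + 1) → ι) :
    Integrable (fun ω => if w 0 = w (Fin.last L) then
      walkProd (edgeMatrix node fun e => Φ e (ω e)) w else 0) (Measure.pi μ) := by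
  split_ifs
  exacts [integrable_walkProd_edgeMatrix hΦ w, integrable_zero _ _ _]

variable [Fintype ι]

theorem integrable_trace_pow_edgeMatrix {ρ : ℝ}
    (hΦ : ∀ e x y, IsCentredSparse (μ e) ρ fun ω => Φ e ω x y) (L : ℕ) :
    Integrable (fun ω => (edgeMatrix node (fun e => Φ e (ω e)) ^ L).trace) (Measure.pi μ) := by
  simp only [trace_pow_eq_sum_walkProd]
  exact integrable_finsetSum _ fun w _ => integrable_ite_walkProd_edgeMatrix hΦ w

open Classical in
theorem integral_trace_pow_edgeMatrix_le {ρ : ℝ} (hρ0 : 0 ≤ ρ) (hρ1 : ρ ≤ 1)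
    (hΦ : ∀ e x y, IsCentredSparse (μ e) ρ fun ω => Φ e ω x y) (L : ℕ) :
    ∫ ω, (edgeMatrix node (fun e => Φ e (ω e)) ^ L).trace ∂Measure.pi μ ≤
      ∑ w : Fin (L + 1) → ι, if IsDoubledClosedWalk fun a => node (w a) then
        ρ ^ (vertexCount (fun a => node (w a)) - 1) else 0 := by
  simp only [trace_pow_eq_sum_walkProd]
  rw [integral_finsetSum _ fun w _ => integrable_ite_walkProd_edgeMatrix hΦ w]
  refine Finset.sum_le_sum fun w _ => ?_
  by_cases hclosed : w 0 = w (Fin.last L)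
  · simp only [hclosed, if_true]
    split_ifs with hw
    · exact integral_walkProd_edgeMatrix_le hρ0 hρ1 hΦ hw.2.1
    · exact (integral_walkProd_edgeMatrix_eq_zero
        (fun e x y => (hΦ e x y).integral_eq_zero) hclosed hw).le
  · simp only [hclosed, if_false, integral_zero]
    split_ifs <;> positivity

end EdgeMatrix

open Classical in
theorem sum_isDoubledClosedWalk_fst {n d L : ℕ} {ρ : ℝ} :
    (∑ w : Fin (L + 1) → Fin n × Fin d, if IsDoubledClosedWalk fun a => (w a).1 then
        ρ ^ (vertexCount (fun a => (w a).1) - 1) else 0) =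
      d ^ (L + 1) * ∑ u : Fin (L + 1) → Fin n,
        if IsDoubledClosedWalk u then ρ ^ (vertexCount u - 1) else 0 := by
  refine (Fintype.sum_equiv (Equiv.arrowProdEquivProdArrow (Fin (L + 1)) (fun _ => Fin n)
    (fun _ => Fin d)) _ (fun z : (Fin (L + 1) → Fin n) × (Fin (L + 1) → Fin d) =>
      if IsDoubledClosedWalk z.1 then ρ ^ (vertexCount z.1 - 1) else 0) fun w => rfl).trans ?_
  rw [Fintype.sum_prod_type]
  simp [Finset.mul_sum]

/-! ### The skew sign comparison matrix -/

/-- The values `2` and `-1` of the comparison variable. -/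
def skewSign (b : Bool) : ℝ := if b then 2 else -1

/-- The distribution under which `skewSign` takes the value `2` with probability `1 / 3`. It is
then centred, and all its other moments are at least one, also the odd ones: this is what a
Rademacher variable lacks. -/
noncomputable def skewMeasure : Measure Bool :=
  bernoulliMeasure true false ⟨1 / 3, by norm_num, by norm_num⟩

instance isProbabilityMeasure_skewMeasure : IsProbabilityMeasure skewMeasure := by
  unfold skewMeasure
  infer_instance

theorem integral_skewMeasure (f : Bool → ℝ) :
    ∫ b, f b ∂skewMeasure = 1 / 3 * f true + 2 / 3 * f false := by
  rw [skewMeasure, integral_bernoulliMeasure]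
  norm_num

theorem integral_skewSign : ∫ b, skewSign b ∂skewMeasure = 0 := by
  norm_num [integral_skewMeasure, skewSign]

theorem one_le_integral_skewSign_pow {j : ℕ} (hj : j ≠ 1) :
    1 ≤ ∫ b, skewSign b ^ j ∂skewMeasure := by
  rw [integral_skewMeasure]
  rcases j with _ | _ | _ | j
  · norm_num
  · exact absurd rfl hj
  · norm_num [skewSign]
  · have hpow : (8 : ℝ) ≤ 2 ^ (j + 3) := by
      rw [pow_add]
      linarith [one_le_pow₀ (n := j) (one_le_two : (1 : ℝ) ≤ 2)]
    rcases neg_one_pow_eq_or ℝ (j + 3) with h | h <;> norm_num [skewSign, h] <;> linarith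

/-- The symmetric matrix with zero diagonal whose entries above the diagonal are the given
skew signs. -/
noncomputable def skewMatrix (r : ℕ) (ω : NodePair r → Bool) : Matrix (Fin r) (Fin r) ℝ :=
  edgeMatrix id fun e => Matrix.of fun _ _ => skewSign (ω e)

theorem one_le_integral_walkProd_skewMatrix {r L : ℕ} {w : Fin (L + 1) → Fin r}
    (hw : IsDoubledClosedWalk w) :
    1 ≤ ∫ ω, walkProd (skewMatrix r ω) w ∂Measure.pi fun _ => skewMeasure := by
  have hloop : ∀ t : Fin L, id (w t.castSucc) ≠ id (w t.succ) := hw.2.1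
  obtain ⟨a, b, hab⟩ := exists_walkProd_edgeMatrix hloop
  simp only [skewMatrix, hab, Matrix.of_apply]
  rw [integral_prod_comp_eval (fun _ => skewMeasure) (fun t => nodePair _ _ (hloop t))
    fun _ => skewSign]
  simp only [Finset.prod_const]
  refine Finset.one_le_prod fun e _ => one_le_integral_skewSign_pow fun hone => ?_
  obtain ⟨t, ht⟩ := Finset.card_eq_one.mp hone
  simp only [Finset.ext_iff, Finset.mem_filter_univ, Finset.mem_singleton] at ht
  obtain ⟨t', hne, ht'⟩ := hw.2.2 t
  refine hne ((ht t').mp ?_)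
  rw [← (ht t).mpr rfl]
  exact (nodePair_eq_iff _ _).mpr ht'

open Classical in
theorem card_isDoubledClosedWalk_le_integral_trace (r L : ℕ) :
    ((Finset.univ.filter fun w : Fin (L + 1) → Fin r => IsDoubledClosedWalk w).card : ℝ) ≤
      ∫ ω, (skewMatrix r ω ^ L).trace ∂Measure.pi fun _ => skewMeasure := by
  simp only [trace_pow_eq_sum_walkProd]
  rw [integral_finsetSum _ fun w _ => Integrable.of_finite, Finset.natCast_card_filter]
  refine Finset.sum_le_sum fun w _ => ?_
  by_cases hclosed : w 0 = w (Fin.last L)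
  · simp only [hclosed, if_true]
    split_ifs with hw
    · exact one_le_integral_walkProd_skewMatrix hw
    · exact (integral_walkProd_edgeMatrix_eq_zero (node := id)
        (Φ := fun _ b => Matrix.of fun _ _ => skewSign b)
        (fun _ _ _ => integral_skewSign) hclosed hw).ge
  · simp [hclosed, IsDoubledClosedWalk]

theorem pow_two_mul_le_factorial_mul_exp (z : ℝ) (k : ℕ) :
    z ^ (2 * k) ≤ (2 * k).factorial * (Real.exp z + Real.exp (-z)) := by
  have h := Real.pow_div_factorial_le_exp |z| (abs_nonneg z) (2 * k)
  rw [(even_two_mul k).pow_abs, div_le_iff₀' (by positivity)] at h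
  exact h.trans (mul_le_mul_of_nonneg_left (Real.exp_abs_le z) (by positivity))

theorem factorial_two_mul_le (k : ℕ) : (2 * k).factorial ≤ (4 * k ^ 2) ^ k :=
  (Nat.factorial_le_pow _).trans_eq (by rw [pow_mul, mul_pow]; norm_num)

section Subgaussian

variable {Ω : Type*} [MeasurableSpace Ω] {μ : Measure Ω} {X : Ω → ℝ} {c : NNReal}

theorem integral_mul_pow_two_mul_le_of_hasSubgaussianMGF (hX : HasSubgaussianMGF X c μ) (s : ℝ)
    (k : ℕ) :
    ∫ ω, (s * X ω) ^ (2 * k) ∂μ ≤ (2 * k).factorial * (2 * Real.exp (c * s ^ 2 / 2)) := by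
  have hint := hX.integrable_exp_mul
  calc ∫ ω, (s * X ω) ^ (2 * k) ∂μ
      ≤ ∫ ω, (2 * k).factorial * (Real.exp (s * X ω) + Real.exp (-s * X ω)) ∂μ := by
        refine integral_mono_of_nonneg (ae_of_all _ fun ω => (even_two_mul k).pow_nonneg _)
          (((hint s).add (hint (-s))).const_mul _) (ae_of_all _ fun ω => ?_)
        simpa only [neg_mul] using pow_two_mul_le_factorial_mul_exp (s * X ω) k
    _ = (2 * k).factorial * (mgf X μ s + mgf X μ (-s)) := by
        rw [integral_const_mul, integral_add (hint s) (hint (-s))]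
        rfl
    _ ≤ (2 * k).factorial * (2 * Real.exp (c * s ^ 2 / 2)) := by
        have hneg := hX.mgf_le (-s)
        rw [neg_sq] at hneg
        rw [two_mul (Real.exp _)]
        exact mul_le_mul_of_nonneg_left (add_le_add (hX.mgf_le s) hneg) (by positivity)

theorem integral_pow_two_mul_le_of_hasSubgaussianMGF (hX : HasSubgaussianMGF X c μ) {C : ℝ}
    (hC : 0 < C) (hcC : c ≤ C) {k : ℕ} (hk : 0 < k) :
    ∫ ω, X ω ^ (2 * k) ∂μ ≤ 2 * (8 * C * k) ^ k := by
  have : (0 : ℝ) < k := by exact_mod_cast hk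
  -- This `s` balances `(2 * k)! / s ^ (2 * k)` against `exp (C * s ^ 2 / 2)`.
  set s := √(k / C)
  have hs2 : s ^ 2 = k / C := Real.sq_sqrt (by positivity)
  have hexp : Real.exp (c * s ^ 2 / 2) ≤ 2 ^ k := by
    have hhalf : Real.exp (1 / 2) ≤ 2 := by
      rw [← Real.le_log_iff_exp_le two_pos]
      linarith [Real.log_two_gt_d9]
    calc Real.exp (c * s ^ 2 / 2) ≤ Real.exp (C * (k / C) / 2) := by rw [hs2]; gcongr
      _ = Real.exp (1 / 2) ^ k := by rw [mul_div_cancel₀ _ hC.ne', ← Real.exp_nat_mul]; ring_nf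
      _ ≤ 2 ^ k := by gcongr
  refine le_of_mul_le_mul_left ?_ (by positivity : 0 < (k / C) ^ k)
  calc (k / C) ^ k * ∫ ω, X ω ^ (2 * k) ∂μ = ∫ ω, (s * X ω) ^ (2 * k) ∂μ := by
        simp only [mul_pow, pow_mul s, hs2, integral_const_mul]
    _ ≤ (2 * k).factorial * (2 * Real.exp (c * s ^ 2 / 2)) :=
        integral_mul_pow_two_mul_le_of_hasSubgaussianMGF hX s k
    _ ≤ (4 * k ^ 2 : ℝ) ^ k * (2 * 2 ^ k) := by
        gcongr
        exact_mod_cast factorial_two_mul_le k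
    _ = 2 * (4 * k ^ 2 * 2 : ℝ) ^ k := by rw [mul_left_comm, ← mul_pow]
    _ = 2 * (k / C * (8 * C * k)) ^ k := by congr 2; field_simp; ring
    _ = (k / C) ^ k * (2 * (8 * C * k) ^ k) := by rw [mul_pow (k / C : ℝ), mul_left_comm]

end Subgaussian

theorem hasSubgaussianMGF_sum_mul_skewSign {E : Type*} [Fintype E] (a : E → ℝ) :
    HasSubgaussianMGF (fun ω : E → Bool => ∑ e, a e * skewSign (ω e))
      (∑ e, ‖a e‖₊ ^ 2 * (9 / 4)) (Measure.pi fun _ => skewMeasure) := by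
  have hskew : HasSubgaussianMGF skewSign (9 / 4) skewMeasure := by
    convert hasSubgaussianMGF_of_mem_Icc_of_integral_eq_zero (a := -1) (b := 2)
      (measurable_of_finite skewSign).aemeasurable
      (ae_of_all _ fun b => by cases b <;> norm_num [skewSign]) integral_skewSign using 1
    ext
    norm_num
  refine HasSubgaussianMGF.sum_of_iIndepFun
    (iIndepFun_pi (μ := fun _ => skewMeasure) (X := fun e b => a e * skewSign b) fun e =>
      (measurable_of_finite _).aemeasurable) fun e _ => ?_
  have hmap : (Measure.pi fun _ : E => skewMeasure).map (fun ω => ω e) = skewMeasure :=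
    (measurePreserving_eval _ e).map_eq
  have heval : HasSubgaussianMGF (skewSign ∘ fun ω : E → Bool => ω e) (9 / 4)
      (Measure.pi fun _ => skewMeasure) :=
    .of_map (measurable_pi_apply e).aemeasurable (by rwa [hmap])
  have hsq : ‖a e‖₊ ^ 2 = ⟨a e ^ 2, sq_nonneg _⟩ := NNReal.eq (sq_abs (a e))
  rw [hsq]
  exact heval.const_mul (a e)

theorem sum_nodePair_add_swap {r : ℕ} (F : Fin r → Fin r → ℝ) :
    ∑ e : NodePair r, (F e.1.1 e.1.2 + F e.1.2 e.1.1) = ∑ i, ∑ j with i ≠ j, F i j := by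
  have hlt : ∀ G : Fin r → Fin r → ℝ,
      ∑ e : NodePair r, G e.1.1 e.1.2 = ∑ i, ∑ j with i < j, G i j := fun G => by
    simp only [Finset.sum_filter]
    rw [← Fintype.sum_prod_type' fun i j : Fin r => if i < j then G i j else 0,
      ← Finset.sum_filter]
    exact (Finset.sum_subtype _ (by simp) fun z : Fin r × Fin r => G z.1 z.2).symm
  have hgt : ∑ i, ∑ j with i < j, F j i = ∑ i, ∑ j with j < i, F i j := by
    simp only [Finset.sum_filter]
    exact Finset.sum_comm
  rw [Finset.sum_add_distrib, hlt F, hlt fun i j => F j i, hgt, ← Finset.sum_add_distrib]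
  refine Finset.sum_congr rfl fun i _ => ?_
  rw [← Finset.sum_union (Finset.disjoint_filter.mpr fun j _ h => h.not_gt)]
  congr 1
  ext j
  simp [lt_or_lt_iff_ne]

theorem sum_mul_skewMatrix_mul {r : ℕ} (x y : Fin r → ℝ) (ω : NodePair r → Bool) :
    ∑ i, ∑ j, x i * skewMatrix r ω i j * y j =
      ∑ e : NodePair r, (x e.1.1 * y e.1.2 + x e.1.2 * y e.1.1) * skewSign (ω e) := by
  have hoff : ∀ i, ∑ j, x i * skewMatrix r ω i j * y j =
      ∑ j with i ≠ j, x i * skewMatrix r ω i j * y j := fun i =>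
    (Finset.sum_filter_of_ne fun j _ hne => by
      rintro rfl
      simp [skewMatrix, edgeMatrix] at hne).symm
  simp only [hoff, ← sum_nodePair_add_swap]
  refine Finset.sum_congr rfl fun e _ => ?_
  have he : e.1.1 < e.1.2 := e.2
  simp only [skewMatrix, edgeMatrix, id, Matrix.of_apply, he, he.not_gt, dif_pos, dif_neg,
    not_false_eq_true]
  ring

theorem sum_nodePair_sq_le {r : ℕ} {x y : EuclideanSpace ℝ (Fin r)} (hx : ‖x‖ ≤ 1)
    (hy : ‖y‖ ≤ 1) :
    ∑ e : NodePair r, (x e.1.1 * y e.1.2 + x e.1.2 * y e.1.1) ^ 2 ≤ 2 := by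
  calc ∑ e : NodePair r, (x e.1.1 * y e.1.2 + x e.1.2 * y e.1.1) ^ 2
      ≤ ∑ e : NodePair r, (2 * (x e.1.1 * y e.1.2) ^ 2 + 2 * (x e.1.2 * y e.1.1) ^ 2) := by
        refine Finset.sum_le_sum fun e _ => ?_
        rw [← mul_add]
        exact add_sq_le
    _ = ∑ i, ∑ j with i ≠ j, 2 * (x i * y j) ^ 2 :=
        sum_nodePair_add_swap fun i j => 2 * (x i * y j) ^ 2
    _ ≤ ∑ i, ∑ j, 2 * (x i * y j) ^ 2 :=
        Finset.sum_le_sum fun i _ => Finset.sum_le_univ_sum_of_nonneg fun j => by positivity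
    _ = 2 * (‖x‖ ^ 2 * ‖y‖ ^ 2) := by
        rw [EuclideanSpace.real_norm_sq_eq, EuclideanSpace.real_norm_sq_eq, Finset.sum_mul_sum]
        simp only [Finset.mul_sum, mul_pow]
    _ ≤ 2 * (1 ^ 2 * 1 ^ 2) := by gcongr
    _ = 2 := by norm_num

theorem integral_pow_sum_mul_skewMatrix_mul_le {r k : ℕ} (hk : 0 < k)
    {x y : EuclideanSpace ℝ (Fin r)} (hx : ‖x‖ ≤ 1) (hy : ‖y‖ ≤ 1) :
    ∫ ω, (∑ i, ∑ j, x i * skewMatrix r ω i j * y j) ^ (2 * k) ∂(Measure.pi fun _ => skewMeasure) ≤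
      2 * (36 * k) ^ k := by
  simp only [sum_mul_skewMatrix_mul]
  convert integral_pow_two_mul_le_of_hasSubgaussianMGF (hasSubgaussianMGF_sum_mul_skewSign _)
    (C := 9 / 2) (by norm_num) _ hk using 3
  · norm_num
  · have h := sum_nodePair_sq_le hx hy
    push_cast
    simp only [Real.norm_eq_abs, sq_abs, ← Finset.sum_mul]
    linarith

theorem integral_trace_pow_skewMatrix_le {r k : ℕ} (hk : 0 < k) :
    ∫ ω, (skewMatrix r ω ^ (2 * k)).trace ∂(Measure.pi fun _ => skewMeasure) ≤
      r * (16 ^ k * (25 ^ r * (2 * (36 * k) ^ k))) := by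
  obtain ⟨N, hcard, hN1, hN⟩ := exists_half_net_closedBall (EuclideanSpace ℝ (Fin r))
  rw [finrank_euclideanSpace, Fintype.card_fin] at hcard
  have hcard2 : ((N ×ˢ N).card : ℝ) ≤ 25 ^ r := by
    have h : N.card * N.card ≤ 5 ^ r * 5 ^ r := Nat.mul_le_mul hcard hcard
    rw [← mul_pow] at h
    exact_mod_cast (Finset.card_product N N).trans_le h
  calc ∫ ω, (skewMatrix r ω ^ (2 * k)).trace ∂(Measure.pi fun _ => skewMeasure)
      ≤ ∫ ω, r * (16 ^ k * ∑ z ∈ N ×ˢ N,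
          (∑ i, ∑ j, z.1 i * skewMatrix r ω i j * z.2 j) ^ (2 * k))
          ∂(Measure.pi fun _ => skewMeasure) := by
        refine integral_mono .of_finite .of_finite fun ω => ?_
        refine (trace_le_card_mul_opNorm _).trans ?_
        rw [Fintype.card_fin]
        exact mul_le_mul_of_nonneg_left ((opNorm_pow_le _ (by omega)).trans
          (opNorm_pow_two_mul_le_sum_of_half_net hN _ k)) (Nat.cast_nonneg _)
    _ = r * (16 ^ k * ∑ z ∈ N ×ˢ N, ∫ ω,
          (∑ i, ∑ j, z.1 i * skewMatrix r ω i j * z.2 j) ^ (2 * k)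
          ∂(Measure.pi fun _ => skewMeasure)) := by
        rw [integral_const_mul, integral_const_mul, integral_finsetSum _ fun _ _ => .of_finite]
    _ ≤ r * (16 ^ k * ∑ z ∈ N ×ˢ N, 2 * (36 * k : ℝ) ^ k) := by
        gcongr with z hz
        obtain ⟨hz1, hz2⟩ := Finset.mem_product.mp hz
        exact integral_pow_sum_mul_skewMatrix_mul_le hk (hN1 _ hz1) (hN1 _ hz2)
    _ ≤ r * (16 ^ k * (25 ^ r * (2 * (36 * k) ^ k))) := by
        rw [Finset.sum_const, nsmul_eq_mul]
        gcongr

open Classical in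
theorem card_isDoubledClosedWalk_le {k : ℕ} (hk : 0 < k) :
    ((Finset.univ.filter fun w : Fin (2 * k + 1) → Fin (3 * k) =>
      IsDoubledClosedWalk w).card : ℝ) ≤ (10 ^ 8 * k) ^ k := by
  refine (card_isDoubledClosedWalk_le_integral_trace _ _).trans
    ((integral_trace_pow_skewMatrix_le hk).trans ?_)
  have hlin : ((3 * k : ℕ) : ℝ) * 2 ≤ 7 ^ k := by
    have h := one_add_mul_le_pow (show (-2 : ℝ) ≤ 6 by norm_num) k
    norm_num at h ⊢
    linarith
  calc ((3 * k : ℕ) : ℝ) * (16 ^ k * (25 ^ (3 * k) * (2 * (36 * k) ^ k)))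
      = (3 * k : ℕ) * 2 * (16 ^ k * 25 ^ (3 * k) * (36 * k) ^ k) := by ring
    _ ≤ 7 ^ k * (16 ^ k * 25 ^ (3 * k) * (36 * k) ^ k) := by gcongr
    _ = (63000000 * k) ^ k := by
        rw [pow_mul, ← mul_pow, ← mul_pow, ← mul_pow]
        norm_num [← mul_assoc]
    _ ≤ (10 ^ 8 * k) ^ k := by gcongr; norm_num

/-! ### Tail bound for the operator norm -/

section Tail

variable {n d : ℕ} {Ω : Type*} [MeasurableSpace Ω] {μ : NodePair n → Measure Ω}
  [∀ e, IsProbabilityMeasure (μ e)]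
  {Φ : NodePair n → Ω → Matrix (Fin n × Fin d) (Fin n × Fin d) ℝ} {ρ : ℝ} {k : ℕ}

open Classical in
theorem integral_trace_pow_edgeMatrix_fst_le (hρ0 : 0 ≤ ρ) (hρ1 : ρ ≤ 1)
    (hΦ : ∀ e x y, IsCentredSparse (μ e) ρ fun ω => Φ e ω x y) (hk : 0 < k) (hnρ : n * ρ ≤ k) :
    ∫ ω, (edgeMatrix Prod.fst (fun e => Φ e (ω e)) ^ (2 * k)).trace ∂Measure.pi μ ≤
      d ^ (2 * k + 1) * (n * (10 ^ 8 * k) ^ k) :=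
  calc ∫ ω, (edgeMatrix Prod.fst (fun e => Φ e (ω e)) ^ (2 * k)).trace ∂Measure.pi μ
      ≤ ∑ w : Fin (2 * k + 1) → Fin n × Fin d, if IsDoubledClosedWalk fun a => (w a).1 then
          ρ ^ (vertexCount (fun a => (w a).1) - 1) else 0 :=
        integral_trace_pow_edgeMatrix_le hρ0 hρ1 hΦ _
    _ = d ^ (2 * k + 1) * ∑ u : Fin (2 * k + 1) → Fin n,
          if IsDoubledClosedWalk u then ρ ^ (vertexCount u - 1) else 0 :=
        sum_isDoubledClosedWalk_fst
    _ ≤ d ^ (2 * k + 1) * (n * (10 ^ 8 * k) ^ k) := by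
        gcongr
        refine (sum_isDoubledClosedWalk_le_mul_card (r := 3 * k) hρ0 hk hnρ (by omega)).trans ?_
        gcongr
        exact card_isDoubledClosedWalk_le hk

theorem measureReal_lt_opNorm_edgeMatrix_mul_le (hρ0 : 0 ≤ ρ) (hρ1 : ρ ≤ 1)
    (hΦ : ∀ e x y, IsCentredSparse (μ e) ρ fun ω => Φ e ω x y) (hk : 0 < k) (hnρ : n * ρ ≤ k)
    {T : ℝ} (hT : 0 ≤ T) :
    T ^ (2 * k) *
        (Measure.pi μ).real {ω | T < opNorm (edgeMatrix Prod.fst fun e => Φ e (ω e))} ≤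
      d ^ (2 * k + 1) * (n * (10 ^ 8 * k) ^ k) := by
  set X := fun ω : NodePair n → Ω => edgeMatrix Prod.fst fun e => Φ e (ω e)
  have htrace : ∀ ω, opNorm (X ω) ^ (2 * k) ≤ (X ω ^ (2 * k)).trace := fun ω =>
    opNorm_pow_two_mul_le_trace (transpose_edgeMatrix _ _) hk
  calc T ^ (2 * k) * (Measure.pi μ).real {ω | T < opNorm (X ω)}
      ≤ T ^ (2 * k) * (Measure.pi μ).real {ω | T ^ (2 * k) ≤ (X ω ^ (2 * k)).trace} := by
        gcongr with ω
        · exact measure_ne_top _ _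
        · exact fun hω => (pow_le_pow_left₀ hT hω.le _).trans (htrace ω)
    _ ≤ ∫ ω, (X ω ^ (2 * k)).trace ∂Measure.pi μ :=
        mul_meas_ge_le_integral_of_nonneg
          (ae_of_all _ fun ω => (pow_nonneg (opNorm_nonneg _) _).trans (htrace ω))
          (integrable_trace_pow_edgeMatrix hΦ _) _
    _ ≤ d ^ (2 * k + 1) * (n * (10 ^ 8 * k) ^ k) :=
        integral_trace_pow_edgeMatrix_fst_le hρ0 hρ1 hΦ hk hnρ

theorem measureReal_lt_opNorm_edgeMatrix_le (hd : 0 < d) (hn : 0 < n) (hρ0 : 0 ≤ ρ)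
    (hρ1 : ρ ≤ 1) (hΦ : ∀ e x y, IsCentredSparse (μ e) ρ fun ω => Φ e ω x y) (hk : 0 < k)
    (hnρ : n * ρ ≤ k) (hlog : Real.log n ≤ k) {γ : ℝ} (hγ : 0 ≤ γ) :
    (Measure.pi μ).real {ω | √(d ^ 3 * 10 ^ 8 * Real.exp (γ + 1) * k) <
      opNorm (edgeMatrix Prod.fst fun e => Φ e (ω e))} ≤ (n : ℝ) ^ (-γ) := by
  have : (0 : ℝ) < k := by exact_mod_cast hk
  have hd1 : (1 : ℝ) ≤ d := by exact_mod_cast hd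
  have hn0 : (0 : ℝ) < n := by exact_mod_cast hn
  have hmarkov := measureReal_lt_opNorm_edgeMatrix_mul_le hρ0 hρ1 hΦ hk hnρ
    (Real.sqrt_nonneg (d ^ 3 * 10 ^ 8 * Real.exp (γ + 1) * k))
  set P := (Measure.pi μ).real {ω | √(d ^ 3 * 10 ^ 8 * Real.exp (γ + 1) * k) <
      opNorm (edgeMatrix Prod.fst fun e => Φ e (ω e))}
  rw [pow_mul, Real.sq_sqrt (by positivity)] at hmarkov
  have hexp : (n : ℝ) ^ (γ + 1) ≤ Real.exp (γ + 1) ^ k := by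
    rw [Real.rpow_def_of_pos hn0, ← Real.exp_nat_mul]
    gcongr
  have hdim : (d : ℝ) ^ (2 * k + 1) ≤ (d ^ 3) ^ k := by
    rw [← pow_mul]
    exact pow_le_pow_right₀ hd1 (by omega)
  set M : ℝ := (d ^ 3) ^ k * (10 ^ 8 * k) ^ k
  have hM : 0 < M * n := by positivity
  have hP : M * n * ((n : ℝ) ^ γ * P) ≤ M * n * 1 := by
    calc M * n * ((n : ℝ) ^ γ * P) = M * ((n : ℝ) ^ (γ + 1) * P) := by
          rw [Real.rpow_add_one hn0.ne']
          ring
      _ ≤ M * (Real.exp (γ + 1) ^ k * P) := by gcongr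
      _ = (d ^ 3 * 10 ^ 8 * Real.exp (γ + 1) * k) ^ k * P := by simp only [M, mul_pow]; ring
      _ ≤ d ^ (2 * k + 1) * (n * (10 ^ 8 * k) ^ k) := hmarkov
      _ ≤ (d ^ 3) ^ k * (n * (10 ^ 8 * k) ^ k) := by gcongr
      _ = M * n * 1 := by ring
  rw [Real.rpow_neg hn0.le, ← one_div, le_div_iff₀' (by positivity)]
  exact le_of_mul_le_mul_left hP hM

end Tail

/-! ### The uniform distribution is centred -/

section UniformDistribution

variable {d : ℕ} {𝒢 : GroupKind}

theorem SyncGroup.mat_mul_transpose (Q : SyncGroup d 𝒢) : Q.mat * Q.mat.transpose = 1 :=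
  (Matrix.mem_orthogonalGroup_iff (Fin d) ℝ).mp Q.1.2

theorem SyncGroup.abs_mat_le_one (Q : SyncGroup d 𝒢) (a b : Fin d) : |Q.mat a b| ≤ 1 :=
  entry_norm_bound_of_unitary (𝕜 := ℝ) Q.1.2 a b

theorem SyncGroup.abs_mat_mul_transpose_le_one (Q S : SyncGroup d 𝒢) (a b : Fin d) :
    |(Q.mat * S.mat.transpose) a b| ≤ 1 :=
  (Q * S⁻¹).abs_mat_le_one a b

theorem SyncGroup.measurable_mat (a b : Fin d) :
    Measurable fun Q : SyncGroup d 𝒢 => Q.mat a b :=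
  ((continuous_subtype_val.comp continuous_subtype_val).matrix_elem a b).measurable

/-- The diagonal reflection that changes the signs of the coordinates in `s`. -/
def flipMatrix (s : Finset (Fin d)) : Matrix (Fin d) (Fin d) ℝ :=
  Matrix.diagonal fun a => if a ∈ s then -1 else 1

theorem flipMatrix_mem_orthogonalGroup (s : Finset (Fin d)) :
    flipMatrix s ∈ Matrix.orthogonalGroup (Fin d) ℝ := by
  rw [Matrix.mem_orthogonalGroup_iff, flipMatrix, Matrix.diagonal_transpose,
    Matrix.diagonal_mul_diagonal, ← Matrix.diagonal_one]
  congr 1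
  ext a
  split_ifs <;> norm_num

theorem det_flipMatrix (s : Finset (Fin d)) : (flipMatrix s).det = (-1) ^ s.card := by
  rw [flipMatrix, Matrix.det_diagonal, Finset.prod_ite_mem, Finset.univ_inter, Finset.prod_const]

theorem exists_mat_mul_eq_neg (h𝒢 : 𝒢 = GroupKind.special → 2 ≤ d) (a : Fin d) :
    ∃ Q : SyncGroup d 𝒢, ∀ (S : SyncGroup d 𝒢) (b : Fin d), (Q * S).mat a b = -S.mat a b := by
  obtain ⟨s, has, hs⟩ : ∃ s : Finset (Fin d), a ∈ s ∧
      (⟨flipMatrix s, flipMatrix_mem_orthogonalGroup s⟩ : Matrix.orthogonalGroup (Fin d) ℝ) ∈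
        syncSubgroup d 𝒢 := by
    cases 𝒢 with
    | orthogonal => exact ⟨{a}, Finset.mem_singleton_self a, Subgroup.mem_top _⟩
    | special =>
      have : Nontrivial (Fin d) := Fin.nontrivial_iff_two_le.mpr (h𝒢 rfl)
      obtain ⟨b, hb⟩ := exists_ne a
      refine ⟨{a, b}, Finset.mem_insert_self a _, (det_flipMatrix _).trans ?_⟩
      rw [Finset.card_pair hb.symm, neg_one_sq]
  refine ⟨⟨_, hs⟩, fun S b => ?_⟩
  change (flipMatrix s * S.mat) a b = -S.mat a b
  rw [flipMatrix, Matrix.diagonal_mul, if_pos has, neg_one_mul]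

theorem integral_mat_unif (h𝒢 : 𝒢 = GroupKind.special → 2 ≤ d) (a b : Fin d) :
    ∫ Q : SyncGroup d 𝒢, Q.mat a b ∂unif d 𝒢 = 0 := by
  obtain ⟨Q, hQ⟩ := exists_mat_mul_eq_neg h𝒢 a
  have : (unif d 𝒢).IsMulLeftInvariant := by unfold unif; infer_instance
  have h := integral_mul_left_eq_self (μ := unif d 𝒢) (fun S : SyncGroup d 𝒢 => S.mat a b) Q
  simp only [hQ, integral_neg] at h
  linarith

end UniformDistribution

/-! ### The centred observation matrix -/

theorem IsCentredSparse.mono {Ω : Type*} [MeasurableSpace Ω] {ν : Measure Ω} {ρ ρ' : ℝ}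
    {f : Ω → ℝ} (hf : IsCentredSparse ν ρ f) (h : ρ ≤ ρ') : IsCentredSparse ν ρ' f where
  __ := hf
  integral_abs_le := hf.integral_abs_le.trans h

theorem isCentredSparse_prod_mul {α β : Type*} [MeasurableSpace α] [MeasurableSpace β]
    {μ : Measure α} {ν : Measure β} [IsProbabilityMeasure μ] [IsProbabilityMeasure ν]
    {f : α → ℝ} {g : β → ℝ} (hf : Measurable f) (hg : Measurable g) (hf1 : ∀ a, |f a| ≤ 1)
    (hg1 : ∀ b, |g b| ≤ 1) (h0 : ∫ a, f a ∂μ = 0 ∨ ∫ b, g b ∂ν = 0) :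
    IsCentredSparse (μ.prod ν) (∫ a, |f a| ∂μ) fun z => f z.1 * g z.2 where
  measurable := (hf.comp measurable_fst).mul (hg.comp measurable_snd)
  abs_le_one z := by
    rw [abs_mul]
    exact mul_le_one₀ (hf1 _) (abs_nonneg _) (hg1 _)
  integral_eq_zero := by rwa [integral_prod_mul, mul_eq_zero]
  integral_abs_le := by
    simp only [abs_mul]
    rw [integral_prod_mul (fun a => |f a|) fun b => |g b|]
    refine mul_le_of_le_one_right (integral_nonneg fun _ => abs_nonneg _) ?_
    have hgint : Integrable (fun b => |g b|) ν :=
      (Integrable.of_bound hg.aestronglyMeasurable 1 (ae_of_all _ hg1)).abs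
    simpa using integral_mono hgint (integrable_const 1) hg1

theorem isCentredSparse_bernoulli_sub_mul {β : Type*} [MeasurableSpace β] (ν : Measure β)
    [IsProbabilityMeasure ν] (p : unitInterval) {c : ℝ} (hc : |c| ≤ 1) :
    IsCentredSparse ((bernoulliMeasure true false p).prod ν) (2 * p * (1 - p))
      fun z => ((z.1.toNat : ℝ) - p) * c := by
  have hp0 := p.2.1
  have hp1 := p.2.2
  refine (isCentredSparse_prod_mul (f := fun b : Bool => (b.toNat : ℝ) - p) (g := fun _ : β => c)
    (measurable_of_finite _) measurable_const (fun b => ?_) (fun _ => hc) (.inl ?_)).mono ?_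
  · cases b <;> simp [abs_le] <;> constructor <;> linarith
  · rw [integral_bernoulliMeasure]
    simp only [Bool.toNat_true, Bool.toNat_false, Nat.cast_one, Nat.cast_zero, smul_eq_mul]
    ring
  · rw [integral_bernoulliMeasure]
    simp only [Bool.toNat_true, Bool.toNat_false, Nat.cast_one, Nat.cast_zero, smul_eq_mul,
      zero_sub, abs_neg, abs_of_nonneg hp0, abs_of_nonneg (sub_nonneg.mpr hp1)]
    exact le_of_eq (by ring)

theorem isCentredSparse_bernoulli_mul {β : Type*} [MeasurableSpace β] {ν : Measure β}
    [IsProbabilityMeasure ν] (q : unitInterval) {g : β → ℝ} (hg : Measurable g)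
    (hg1 : ∀ b, |g b| ≤ 1) (hg0 : ∫ b, g b ∂ν = 0) :
    IsCentredSparse ((bernoulliMeasure true false q).prod ν) q
      fun z => (z.1.toNat : ℝ) * g z.2 := by
  refine (isCentredSparse_prod_mul (f := fun b : Bool => (b.toNat : ℝ))
    (measurable_of_finite _) hg (fun b => ?_) hg1 (.inr hg0)).mono ?_
  · cases b <;> simp
  · rw [integral_bernoulliMeasure]
    simp

section Model

variable {n K d : ℕ} {𝒢 : GroupKind}

/-- The difference between the block observed at the pair `e` and its expectation, as a function
of the edge indicator and the outlier measurement of `e`. -/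
noncomputable def centredBlock (p : unitInterval) (C : Fin n → Fin K) (R : Fin n → SyncGroup d 𝒢)
    (e : NodePair n) (z : Bool × SyncGroup d 𝒢) : Matrix (Fin d) (Fin d) ℝ :=
  if C e.1.1 = C e.1.2 then
    ((z.1.toNat : ℝ) - p) • ((R e.1.1).mat * (R e.1.2).mat.transpose)
  else (z.1.toNat : ℝ) • z.2.mat

theorem isCentredSparse_centredBlock (h𝒢 : 𝒢 = GroupKind.special → 2 ≤ d) (p q : unitInterval)
    (C : Fin n → Fin K) (R : Fin n → SyncGroup d 𝒢) (e : NodePair n) (a b : Fin d) :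
    IsCentredSparse
      ((bernoulliMeasure true false (if C e.1.1 = C e.1.2 then p else q)).prod (unif d 𝒢))
      (max (2 * p * (1 - p)) q) fun z => centredBlock p C R e z a b := by
  unfold centredBlock
  split_ifs
  · exact (isCentredSparse_bernoulli_sub_mul _ p
      (SyncGroup.abs_mat_mul_transpose_le_one _ _ a b)).mono (le_max_left _ _)
  · exact (isCentredSparse_bernoulli_mul q (SyncGroup.measurable_mat a b)
      (fun Q => Q.abs_mat_le_one a b) (integral_mat_unif h𝒢 a b)).mono (le_max_right _ _)

theorem groundTruth_mul_transpose_apply (C : Fin n → Fin K) (R : Fin n → SyncGroup d 𝒢)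
    (x y : Fin n × Fin d) : (groundTruth C R * (groundTruth C R).transpose) x y =
      if C x.1 = C y.1 then ((R x.1).mat * (R y.1).mat.transpose) x.2 y.2 else 0 := by
  simp only [Matrix.mul_apply, Matrix.transpose_apply, groundTruth, Matrix.of_apply,
    clusteringMatrix, Fintype.sum_prod_type]
  simp [eq_comm (a := C y.1)]

theorem upperBlock_sub_eq_centredBlock (p : unitInterval) (C : Fin n → Fin K)
    (R : Fin n → SyncGroup d 𝒢) (ω : SGBMOutcome n d 𝒢) (e : NodePair n) :
    upperBlock C R ω e - (p : ℝ) • (if C e.1.1 = C e.1.2 then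
      (R e.1.1).mat * (R e.1.2).mat.transpose else 0) = centredBlock p C R e (ω e) := by
  unfold upperBlock centredBlock
  cases (ω e).1 <;> by_cases h : C e.1.1 = C e.1.2 <;> simp [h, sub_smul]

theorem transpose_observation (C : Fin n → Fin K) (R : Fin n → SyncGroup d 𝒢)
    (ω : SGBMOutcome n d 𝒢) : (observation C R ω).transpose = observation C R ω := by
  ext x y
  simp only [observation, observationBlock, Matrix.transpose_apply, Matrix.of_apply]
  rcases lt_trichotomy x.1 y.1 with h | h | h
  · simp [h, h.not_gt]
  · simp [h, Matrix.one_apply, eq_comm (a := x.2)]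
  · simp [h, h.not_gt]

theorem observation_sub_eq (p : unitInterval) (C : Fin n → Fin K) (R : Fin n → SyncGroup d 𝒢)
    (ω : SGBMOutcome n d 𝒢) :
    observation C R ω - (p : ℝ) • (groundTruth C R * (groundTruth C R).transpose) =
      edgeMatrix Prod.fst (fun e => (centredBlock p C R e (ω e)).submatrix Prod.snd Prod.snd) +
        (1 - p : ℝ) • 1 := by
  set Y := observation C R ω - (p : ℝ) • (groundTruth C R * (groundTruth C R).transpose) with hY
  set Z := edgeMatrix Prod.fst
    (fun e => (centredBlock p C R e (ω e)).submatrix Prod.snd Prod.snd) + (1 - p : ℝ) • 1 with hZ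
  have hYsymm : Y.transpose = Y := by
    simp [hY, transpose_observation, Matrix.transpose_mul]
  have hZsymm : Z.transpose = Z := by
    simp [hZ, transpose_edgeMatrix]
  ext x y
  wlog h : x.1 ≤ y.1 generalizing x y
  · rw [← hYsymm, ← hZsymm]
    exact this y x (le_of_not_ge h)
  simp only [hY, hZ, Matrix.sub_apply, Matrix.add_apply, Matrix.smul_apply,
    groundTruth_mul_transpose_apply, smul_eq_mul, observation, observationBlock, edgeMatrix,
    Matrix.of_apply]
  rcases h.lt_or_eq with h | h
  · have hne : x ≠ y := fun hxy => h.ne (congrArg Prod.fst hxy)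
    have hblock := congrFun₂ (upperBlock_sub_eq_centredBlock p C R ω ⟨(x.1, y.1), h⟩) x.2 y.2
    rw [dif_pos h, dif_pos h, Matrix.one_apply_ne hne, mul_zero, add_zero, Matrix.submatrix_apply,
      ← hblock, Matrix.sub_apply, Matrix.smul_apply, smul_eq_mul]
    split_ifs <;> rfl
  · simp only [h, lt_irrefl, dif_neg, not_false_eq_true, if_true, zero_add,
      SyncGroup.mat_mul_transpose, Matrix.one_apply, Prod.ext_iff, true_and]
    ring

theorem IsBalanced.card_eq {m : ℕ} {C : Fin n → Fin K} (hC : IsBalanced m C) : n = K * m := by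
  have h := Finset.card_eq_sum_card_fiberwise (f := C) (s := Finset.univ) (t := Finset.univ)
    fun _ _ => by simp
  simpa [hC _] using h

theorem opNorm_observation_sub_le (p : unitInterval) (C : Fin n → Fin K)
    (R : Fin n → SyncGroup d 𝒢) (ω : SGBMOutcome n d 𝒢) :
    opNorm (observation C R ω - (p : ℝ) • (groundTruth C R * (groundTruth C R).transpose)) ≤
      opNorm (edgeMatrix Prod.fst fun e =>
        (centredBlock p C R e (ω e)).submatrix Prod.snd Prod.snd) + 1 := by
  have hp0 := p.2.1
  have hp1 := p.2.2
  rw [observation_sub_eq]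
  refine (opNorm_add_le _ _).trans (add_le_add_right ((opNorm_smul_one_le _).trans ?_) _)
  rw [abs_le]
  constructor <;> linarith

theorem one_sub_measureReal_le {Ω : Type*} [MeasurableSpace Ω] {μ : Measure Ω}
    [IsProbabilityMeasure μ] {s t : Set Ω} (h : sᶜ ⊆ t) : 1 - μ.real s ≤ μ.real t := by
  rw [sub_le_iff_le_add', ← probReal_univ (μ := μ), ← Set.union_compl_self s]
  exact (measureReal_union_le s sᶜ).trans (add_le_add_right (measureReal_mono h) _)

theorem one_sub_rpow_le_measureReal_opNorm_observation_sub_le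
    (h𝒢 : 𝒢 = GroupKind.special → 2 ≤ d) (hd : 0 < d) (hn : 0 < n) {p q : unitInterval} {k : ℕ}
    (hk : 0 < k) (hpq : 2 * ((p : ℝ) * n) + q * n ≤ k) (hlog : Real.log n ≤ k) {γ : ℝ} (hγ : 0 ≤ γ)
    (C : Fin n → Fin K) (R : Fin n → SyncGroup d 𝒢) :
    1 - (n : ℝ) ^ (-γ) ≤ (sgbm p q C d 𝒢).real {ω |
      opNorm (observation C R ω - (p : ℝ) • (groundTruth C R * (groundTruth C R).transpose)) ≤
        √(d ^ 3 * 10 ^ 8 * Real.exp (γ + 1) * k) + 1} := by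
  have hp0 := p.2.1
  have hq0 := q.2.1
  set ρ : ℝ := max (2 * p * (1 - p)) q
  have hρ0 : 0 ≤ ρ := hq0.trans (le_max_right _ _)
  have hρ1 : ρ ≤ 1 := max_le (by nlinarith [sq_nonneg (2 * (p : ℝ) - 1)]) q.2.2
  have hρ : ρ ≤ 2 * p + q := max_le (by nlinarith) (by linarith)
  have hnρ : n * ρ ≤ k := (mul_le_mul_of_nonneg_left hρ n.cast_nonneg).trans (by linarith)
  have htail := measureReal_lt_opNorm_edgeMatrix_le hd hn hρ0 hρ1
    (Φ := fun e z => (centredBlock p C R e z).submatrix Prod.snd Prod.snd)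
    (fun e x y => isCentredSparse_centredBlock h𝒢 p q C R e x.2 y.2) hk hnρ hlog hγ
  refine (sub_le_sub_left htail 1).trans (one_sub_measureReal_le fun ω hω => ?_)
  have hω' : ¬ √(d ^ 3 * 10 ^ 8 * Real.exp (γ + 1) * k) < opNorm (edgeMatrix Prod.fst fun e =>
      (centredBlock p C R e (ω e)).submatrix Prod.snd Prod.snd) := hω
  exact (opNorm_observation_sub_le p C R ω).trans (add_le_add_left (not_lt.mp hω') 1)

end Model

theorem sqrt_mul_add_one_le {B k a b l : ℝ} (hB : 0 ≤ B) (ha : 0 ≤ a) (hb : 0 ≤ b)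
    (hl : 1 ≤ 2 * l) (hk : k ≤ 2 * a + b + 3 * l) :
    √(B * k) + 1 ≤ 2 * (√B + 1) * (√a + √b + √l) := by
  have hl0 : 0 ≤ l := by linarith
  have hl1 : 1 ≤ 2 * √l := by
    have : 1 / 2 ≤ √l := Real.le_sqrt_of_sq_le (by linarith)
    linarith
  have hsqrt : √k ≤ 2 * (√a + √b + √l) := by
    rw [Real.sqrt_le_left (by positivity)]
    have hab := mul_nonneg (Real.sqrt_nonneg a) (Real.sqrt_nonneg b)
    have hal := mul_nonneg (Real.sqrt_nonneg a) (Real.sqrt_nonneg l)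
    have hbl := mul_nonneg (Real.sqrt_nonneg b) (Real.sqrt_nonneg l)
    nlinarith [Real.sq_sqrt ha, Real.sq_sqrt hb, Real.sq_sqrt hl0]
  calc √(B * k) + 1 ≤ √B * (2 * (√a + √b + √l)) + 2 * √l := by
        rw [Real.sqrt_mul hB]
        gcongr
    _ ≤ 2 * (√B + 1) * (√a + √b + √l) := by
        linarith [Real.sqrt_nonneg a, Real.sqrt_nonneg b]

theorem one_le_two_mul_log {n : ℕ} (hn : 2 ≤ n) : 1 ≤ 2 * Real.log n := by
  have hlog : Real.log 2 ≤ Real.log n := Real.log_le_log two_pos (by exact_mod_cast hn)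
  linarith [Real.log_two_gt_d9]

theorem mainTheorem5_general (d : ℕ) (hd : 0 < d) (𝒢 : GroupKind)
    (h𝒢 : 𝒢 = GroupKind.special → 2 ≤ d) (γ : ℝ) (hγ : 0 ≤ γ) :
    ∃ c : ℝ, 0 < c ∧
      ∀ (n K : ℕ) (_ : 0 < n) (p q : unitInterval) (C : Fin n → Fin K) (R : Fin n → SyncGroup d 𝒢),
        1 - (n : ℝ) ^ (-γ) ≤
          (sgbm p q C d 𝒢).real {ω |
            opNorm (observation C R ω - (p : ℝ) • (groundTruth C R * (groundTruth C R).transpose))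
              ≤ c * (√((p : ℝ) * n) + √((q : ℝ) * n) + √(Real.log n))} := by
  set B : ℝ := d ^ 3 * 10 ^ 8 * Real.exp (γ + 1)
  refine ⟨2 * (√B + 1), by positivity, fun n K hn p q C R => ?_⟩
  obtain rfl | hn2 : n = 1 ∨ 2 ≤ n := by omega
  · simp
  have hlog := one_le_two_mul_log hn2
  have hp := p.2.1
  have hq := q.2.1
  set s : ℝ := 2 * (p * n) + q * n
  have hs : 0 ≤ s := by positivity
  set k : ℕ := ⌈s + Real.log n⌉₊
  have hk : s + Real.log n ≤ k := Nat.le_ceil _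
  have hk' : k < s + Real.log n + 1 := Nat.ceil_lt_add_one (by linarith)
  have hk0 : 0 < k := Nat.ceil_pos.mpr (by linarith)
  refine (one_sub_rpow_le_measureReal_opNorm_observation_sub_le (k := k) h𝒢 hd hn hk0
    (by linarith) (by linarith) hγ C R).trans (measureReal_mono fun ω hω => ?_)
  have hω' : opNorm (observation C R ω -
      (p : ℝ) • (groundTruth C R * (groundTruth C R).transpose)) ≤ √(B * k) + 1 := hω
  exact hω'.trans
    (sqrt_mul_add_one_le (by positivity) (by positivity) (by positivity) hlog (by linarith))

theorem mainTheorem5 (K d : ℕ) (hK : 0 < K) (hd : 0 < d) (𝒢 : GroupKind)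
    (h𝒢 : 𝒢 = GroupKind.special → 2 ≤ d) :
    ∃ c₁ c₂ c₃ γ : ℝ, 0 < c₁ ∧ 0 < c₂ ∧ 0 < c₃ ∧ 0 < γ ∧
      ∀ (n m : ℕ) (_ : 0 < m) (p q : unitInterval) (C : Fin n → Fin K) (_ : IsBalanced m C)
        (R : Fin n → SyncGroup d 𝒢),
        1 - (n : ℝ) ^ (-γ) ≤
          (sgbm p q C d 𝒢).real {ω |
            opNorm (observation C R ω - (p : ℝ) • (groundTruth C R * (groundTruth C R).transpose))
              ≤ c₁ * √((q : ℝ) * m) + c₂ * √((p : ℝ) * m) + c₃ * √(Real.log n)} := by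
  obtain ⟨c, hc, h⟩ := mainTheorem5_general d hd 𝒢 h𝒢 1 zero_le_one
  refine ⟨c * √K, c * √K, c, 1, by positivity, by positivity, hc, one_pos,
    fun n m hm p q C hC R => ?_⟩
  obtain rfl := hC.card_eq
  convert h (K * m) K (Nat.mul_pos hK hm) p q C R using 5
  push_cast
  rw [mul_left_comm (p : ℝ), mul_left_comm (q : ℝ), Real.sqrt_mul (Nat.cast_nonneg K),
    Real.sqrt_mul (Nat.cast_nonneg K)]
  ring
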